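/- Let $n\ge1$, $p\ge0$ be integers, $\sigma>0$, $\lambda\ge0$, $\mu\in\mathbb R^n$, and consider the sequence model $y=\mu+\varepsilon$ with $\varepsilon\sim N(0,\sigma^2 I_n)$. Let $X\in\mathbb R^{n\times p}$ be a deterministic matrix with columns $x_1,\dots,x_p$ such that for all $\delta_1,\dots,\delta_p\in\{-1,1\}$ and all $1\le j_0<j_1<\dots<j_n\le p$, $$\operatorname{rank}\begin{pmatrix}x_{j_0}&x_{j_1}&\cdots&x_{j_n}\\ \delta_{j_0}&\delta_{j_1}&\cdots&\delta_{j_n}\end{pmatrix}=n+1 .$$ Let $\hat\beta=\hat\beta(y)$ be the Lasso, i.e. $\hat\beta(y)\in\arg\min_{b\in\mathbb R^p}\{\|Xb-y\|^2/(2n)+\lambda\|b\|_1\}$ for every $y\in\mathbb R^n$, and let $\hat S=\{j:\hat\beta_j\ne0\}$. (If $p>n$ and $\lambda>0$ the rank condition makes the minimizer unique. If $p\le n$, where the rank condition is void, or if $\lambda=0$, the minimizer need not be unique; then $\hat\beta(y)$ denotes, for every $y$, a minimizer for which the columns $x_j$, $j\in\hat S$, are linearly independent.) Define $$\widehat{\mathrm{SURE}}=\|y-X\hat\beta\|^2+\sigma^2(2|\hat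 S|-n),\qquad \hat R=4\sigma^2\|y-X\hat\beta\|^2+\sigma^4(4|\hat S|-2n).$$ Then $\widehat{\mathrm{SURE}}$, $\hat R$, $\|y-X\hat\beta\|^2$ and $\|X\hat\beta-\mu\|^2$ are square integrable, and the following hold. (i) $\operatorname{Var}(\widehat{\mathrm{SURE}})=\mathbb E\big[(\widehat{\mathrm{SURE}}-\mathbb E[\|X\hat\beta-\mu\|^2])^2\big]\le\mathbb E[\hat R]+\sigma^4 n$. (ii) $\mathbb E[\hat R]=2\sigma^2\,\mathbb E\big[\|y-X\hat\beta\|^2+\widehat{\mathrm{SURE}}\big]\ge n\sigma^4$. (iii) $\operatorname{Var}(\hat R)\le16\sigma^4\,\mathbb E[\hat R]$. (iv) $\mathbb E\big[|\hat R/\mathbb E[\hat R]-1|^2\big]\le16/n$. Consequently, along any sequence of such models with $n\to\infty$ (where $p,X,\mu,\sigma,\lambda$ may vary arbitrarily with $n$), the ratio $\hat R/\mathbb E[\hat R]$ converges to $1$ in $L_2$ and in probability. (v) For all $\alpha,\gamma\in(0,1)$ with $n\alpha>16$, with probability at least $1-\alpha-\gamma$, $$\Big|\widehat{\mathrm{SURE}}-\|X\hat\beta-\mu\|^2\Big|^2\le\gamma^{-1}\hat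 R\,\big(1-4(n\alpha)^{-1/2}\big)^{-1}.$$ -/

import Mathlib

open MeasureTheory ProbabilityTheory Filter Topology

namespace LassoSURE

noncomputable section

/-- The vector `X b`, as an element of the Euclidean space `ℝⁿ`. -/
def fit {n p : ℕ} (X : Matrix (Fin n) (Fin p) ℝ) (b : Fin p → ℝ) : EuclideanSpace ℝ (Fin n) :=
  WithLp.toLp 2 (X.mulVec b)

/-- The Lasso objective `‖X b - y‖² / (2 n) + lam ‖b‖₁`. -/
def objective {n p : ℕ} (X : Matrix (Fin n) (Fin p) ℝ) (lam : ℝ)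
    (y : EuclideanSpace ℝ (Fin n)) (b : Fin p → ℝ) : ℝ :=
  ‖fit X b - y‖ ^ 2 / (2 * (n : ℝ)) + lam * ∑ j, |b j|

/-- `b` solves the Lasso problem with data `(X, y)` and tuning parameter `lam`. -/
def IsLasso {n p : ℕ} (X : Matrix (Fin n) (Fin p) ℝ) (lam : ℝ)
    (y : EuclideanSpace ℝ (Fin n)) (b : Fin p → ℝ) : Prop :=
  ∀ b' : Fin p → ℝ, objective X lam y b ≤ objective X lam y b'

/-- The support `{j : b j ≠ 0}` of a coefficient vector. -/
def support {p : ℕ} (b : Fin p → ℝ) : Finset (Fin p) :=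
  {j | b j ≠ 0}

/-- For all signs `δ` and all `j₀ < ⋯ < jₙ`, the `(n + 1) × (n + 1)` matrix with columns
`(x_{j_k}, δ_{j_k})` has rank `n + 1`. -/
def RankCondition {n p : ℕ} (X : Matrix (Fin n) (Fin p) ℝ) : Prop :=
  ∀ δ : Fin p → ℝ, (∀ j, δ j = -1 ∨ δ j = 1) →
    ∀ J : Fin (n + 1) → Fin p, StrictMono J →
      (Matrix.fromRows (X.submatrix id J)
        (Matrix.of fun (_ : Unit) k => δ (J k))).rank = n + 1

/-- The estimator `‖y - X b‖² + σ² (2 |supp b| - n)`, with `b` the Lasso solution at `y`. -/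
def sure {n p : ℕ} (X : Matrix (Fin n) (Fin p) ℝ) (σ : ℝ)
    (y : EuclideanSpace ℝ (Fin n)) (b : Fin p → ℝ) : ℝ :=
  ‖y - fit X b‖ ^ 2 + σ ^ 2 * (2 * ((support b).card : ℝ) - (n : ℝ))

/-- The estimator `4 σ² ‖y - X b‖² + σ⁴ (4 |supp b| - 2 n)`, with `b` the Lasso solution
at `y`. -/
def sureForSure {n p : ℕ} (X : Matrix (Fin n) (Fin p) ℝ) (σ : ℝ)
    (y : EuclideanSpace ℝ (Fin n)) (b : Fin p → ℝ) : ℝ :=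
  4 * σ ^ 2 * ‖y - fit X b‖ ^ 2 + σ ^ 4 * (4 * ((support b).card : ℝ) - 2 * (n : ℝ))

/-- The sequence model `y = μ + ε`, `ε ∼ N(0, σ² Iₙ)`, with a design `X` satisfying the rank
condition and a Lasso estimator `βhat : ℝⁿ → ℝᵖ` with tuning parameter `lam ≥ 0`.

If `n < p` and `0 < lam`, then the rank condition makes the Lasso solution unique, and nothing
is asked of `βhat` beyond `isLasso`. In the remaining cases (the rank condition is void for
`p ≤ n`) the minimizer need not be unique, and `βhat` has to select one whose active columns
`x_j` are linearly independent. No measurability of `βhat` is assumed. -/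
structure Model {n p : ℕ} {Ω : Type*} [MeasurableSpace Ω] (P : Measure Ω)
    (X : Matrix (Fin n) (Fin p) ℝ) (μ : EuclideanSpace ℝ (Fin n)) (σ lam : ℝ)
    (ε y : Ω → EuclideanSpace ℝ (Fin n))
    (βhat : EuclideanSpace ℝ (Fin n) → Fin p → ℝ) : Prop where
  n_pos : 0 < n
  sigma_pos : 0 < σ
  lam_nonneg : 0 ≤ lam
  noise : HasLaw ε (multivariateGaussian 0 (σ ^ 2 • (1 : Matrix (Fin n) (Fin n) ℝ))) P
  observation : ∀ ω, y ω = μ + ε ω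
  design : RankCondition X
  isLasso : ∀ z, IsLasso X lam z (βhat z)
  selection : p ≤ n ∨ lam = 0 → ∀ z,
    LinearIndependent ℝ (fun j : support (βhat z) => X.col (j : Fin p))

end

end LassoSURE

/-! Put `G z = σ⁻¹ (X βhat(μ + σ z) - μ)` with `z` standard Gaussian. The variational inequality of
the Lasso makes `G` 1-Lipschitz. On each of the finitely many sets where the sign vector of `βhat`
is constant, stationarity forces increments of `G` to be the orthogonal projection of increments of
`z` onto the span of the active columns. Hence `DG` is almost everywhere an orthogonal projection
`A`; its rank is the support size because the active columns are independent (by the rank condition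
or by the choice of minimizer).

For a field `g` write `δg = ⟪z, g⟫ - tr Dg`. Gaussian integration by parts gives `E δg = 0`, `E[h
δg] = E⟪∇h, g⟫` and the second order Stein identity `E (δg)² = E[‖g‖² + tr (Dg)²]`. Together with
the Poincaré inequality `Var h ≤ E‖∇h‖²` they yield `Var (h + δg) ≤ E[‖∇h + g‖² + tr (Dg)²]`. These
are proved for smooth `g` of polynomial growth, then passed to fields built from the Lipschitz `G`
by mollification.

After rescaling, SURE is `‖G‖² + δ(z - 2G)`. Since `I - 2A` is an involution, its squared error has
mean `E[‖2G - z‖² + n]`, which is the mean of the rescaled `R̂`; so that mean is at least `n`. For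
the variance of SURE, `∇‖G‖² + z - 2G = A z + (I - A)(z - 2G)`, an orthogonal sum. For `R̂ = 4 (‖G‖²
- ⟪z, G⟫ + δ(z - G)) + 2n`, the gradient and the field cancel down to `(I - A)(z - 2G)`, which gives
`Var R̂ ≤ 16 E R̂`. Markov and Chebyshev give the ratio and confidence statements. The main carriers
are `integral_divergence_sq_stdGaussian`, `variance_add_divergence_le_stdGaussian`,
`exists_smoothApprox`, `ae_fderiv_fit` and `sure_of_ae_projection`. -/

namespace LassoSURE

open scoped RealInnerProductSpace NNReal

set_option linter.unusedSectionVars false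

/-! ### Functions of polynomial growth. -/

section Tame

variable {E F G H : Type*} [NormedAddCommGroup E] [NormedSpace ℝ E]
  [NormedAddCommGroup F] [NormedSpace ℝ F] [NormedAddCommGroup G] [NormedSpace ℝ G]
  [NormedAddCommGroup H] [NormedSpace ℝ H]

/-- Continuous functions of at most polynomial growth. -/
structure Tame (u : E → F) : Prop where
  continuous : Continuous u
  growth : ∃ (C : ℝ) (m : ℕ), 0 ≤ C ∧ ∀ z, ‖u z‖ ≤ C * (1 + ‖z‖) ^ m

namespace Tame

theorem of_le {u : E → F} (hu : Continuous u) (C : ℝ) (m : ℕ)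
    (h : ∀ z, ‖u z‖ ≤ C * (1 + ‖z‖) ^ m) : Tame u :=
  ⟨hu, C, m, by simpa using (norm_nonneg _).trans (h 0), h⟩

theorem const (c : F) : Tame (fun _ : E => c) :=
  .of_le continuous_const ‖c‖ 0 fun z => by simp

theorem clm (L : E →L[ℝ] F) : Tame (fun z => L z) :=
  .of_le L.continuous ‖L‖ 1 fun z => by
    rw [pow_one]
    exact (L.le_opNorm z).trans (by gcongr; linarith)

theorem id' : Tame (fun z : E => z) := clm (ContinuousLinearMap.id ℝ E)

theorem add {u v : E → F} (hu : Tame u) (hv : Tame v) : Tame (fun z => u z + v z) := by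
  obtain ⟨C, m, hC, h⟩ := hu.growth
  obtain ⟨D, k, hD, h'⟩ := hv.growth
  refine .of_le (hu.continuous.add hv.continuous) (C + D) (m + k) fun z => ?_
  have h1 : (1 : ℝ) ≤ 1 + ‖z‖ := by linarith [norm_nonneg z]
  have e1 : (1 + ‖z‖) ^ m ≤ (1 + ‖z‖) ^ (m + k) := pow_le_pow_right₀ h1 (by omega)
  have e2 : (1 + ‖z‖) ^ k ≤ (1 + ‖z‖) ^ (m + k) := pow_le_pow_right₀ h1 (by omega)
  calc ‖u z + v z‖ ≤ ‖u z‖ + ‖v z‖ := norm_add_le _ _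
    _ ≤ C * (1 + ‖z‖) ^ (m + k) + D * (1 + ‖z‖) ^ (m + k) :=
      add_le_add ((h z).trans (by gcongr)) ((h' z).trans (by gcongr))
    _ = _ := by ring

theorem bilin (B : F →L[ℝ] G →L[ℝ] H) {u : E → F} {v : E → G} (hu : Tame u) (hv : Tame v) :
    Tame (fun z => B (u z) (v z)) := by
  obtain ⟨C, m, hC, h⟩ := hu.growth
  obtain ⟨D, k, hD, h'⟩ := hv.growth
  refine .of_le (by have := hu.continuous; have := hv.continuous; fun_prop)
    (‖B‖ * C * D) (m + k) fun z => ?_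
  calc ‖B (u z) (v z)‖ ≤ ‖B‖ * ‖u z‖ * ‖v z‖ := B.le_opNorm₂ _ _
    _ ≤ ‖B‖ * (C * (1 + ‖z‖) ^ m) * (D * (1 + ‖z‖) ^ k) := by gcongr; exacts [h z, h' z]
    _ = _ := by ring

theorem mul {u v : E → ℝ} (hu : Tame u) (hv : Tame v) : Tame (fun z => u z * v z) :=
  bilin (ContinuousLinearMap.mul ℝ ℝ) hu hv

theorem smul {u : E → ℝ} {v : E → F} (hu : Tame u) (hv : Tame v) : Tame (fun z => u z • v z) :=
  bilin (ContinuousLinearMap.lsmul ℝ ℝ) hu hv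

theorem apply {u : E → F →L[ℝ] G} {v : E → F} (hu : Tame u) (hv : Tame v) :
    Tame (fun z => u z (v z)) :=
  bilin (ContinuousLinearMap.id ℝ (F →L[ℝ] G)) hu hv

theorem comp {u : F → G} {w : E → F} (hu : Tame u) (hw : Tame w) : Tame (fun z => u (w z)) := by
  obtain ⟨C, m, hC, h⟩ := hu.growth
  obtain ⟨D, k, hD, h'⟩ := hw.growth
  refine .of_le (hu.continuous.comp hw.continuous) (C * (1 + D) ^ m) (k * m) fun z => ?_
  have h1 : (1 : ℝ) ≤ (1 + ‖z‖) ^ k := one_le_pow₀ (by linarith [norm_nonneg z])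
  calc ‖u (w z)‖ ≤ C * (1 + ‖w z‖) ^ m := h _
    _ ≤ C * (1 * (1 + ‖z‖) ^ k + D * (1 + ‖z‖) ^ k) ^ m := by
        gcongr
        · linarith
        · exact h' z
    _ = _ := by rw [← add_mul, mul_pow, pow_mul]; ring

theorem neg {u : E → F} (hu : Tame u) : Tame (fun z => -u z) := by
  simpa using (const (-1 : ℝ)).smul hu

theorem sub {u v : E → F} (hu : Tame u) (hv : Tame v) : Tame (fun z => u z - v z) := by
  simpa [sub_eq_add_neg] using hu.add hv.neg

theorem norm {u : E → F} (hu : Tame u) : Tame (fun z => ‖u z‖) := by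
  obtain ⟨C, m, hC, h⟩ := hu.growth
  exact .of_le hu.continuous.norm C m fun z => by simpa using h z

theorem pow {u : E → ℝ} (hu : Tame u) (k : ℕ) : Tame (fun z => u z ^ k) := by
  induction k with
  | zero => simpa using const (1 : ℝ)
  | succ k ih => simpa [pow_succ] using ih.mul hu

theorem sum {ι : Type*} (s : Finset ι) {u : ι → E → F} (hu : ∀ i, Tame (u i)) :
    Tame (fun z => ∑ i ∈ s, u i z) := by
  classical
  induction s using Finset.induction_on with
  | empty => simpa using const (0 : F)
  | insert i s hi ih => simpa [Finset.sum_insert hi] using (hu i).add ih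

theorem inner {F : Type*} [NormedAddCommGroup F] [InnerProductSpace ℝ F] {u v : E → F}
    (hu : Tame u) (hv : Tame v) : Tame (fun z => ⟪u z, v z⟫) :=
  bilin (innerSL ℝ) hu hv

/-- Gaussian measures have moments of all orders, so closure of `Tame` under algebra settles every
integrability question for smooth fields. -/
theorem integrable [MeasurableSpace E] [BorelSpace E] [SecondCountableTopology E]
    [CompleteSpace E] {u : E → F} (hu : Tame u) (γ : Measure E) [IsGaussian γ] :
    Integrable u γ := by
  obtain ⟨C, m, hC, h⟩ := hu.growth
  have h0 : MemLp (fun z : E => ‖z‖) (m : ENNReal) γ :=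
    (IsGaussian.memLp_id γ (m : ENNReal) (ENNReal.natCast_ne_top m)).norm
  have h1 : MemLp (fun z : E => 1 + ‖z‖) (m : ENNReal) γ :=
    MemLp.add (f := fun _ : E => (1 : ℝ)) (memLp_const (1 : ℝ)) h0
  have h2 : Integrable (fun z : E => C * ‖1 + ‖z‖‖ ^ m) γ :=
    h1.integrable_norm_pow'.const_mul C
  refine h2.mono' hu.continuous.aestronglyMeasurable (Eventually.of_forall fun z => ?_)
  rw [Real.norm_of_nonneg (by positivity : 0 ≤ 1 + ‖z‖)]
  exact h z

end Tame

end Tame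

/-! ### Gaussian density and Stein's lemma. -/

section Stein

variable {E : Type*} [NormedAddCommGroup E] [InnerProductSpace ℝ E] [FiniteDimensional ℝ E]
  [MeasurableSpace E] [BorelSpace E]

variable (E) in
/-- The density of the standard Gaussian measure with respect to Lebesgue measure. -/
noncomputable def stdDensity (z : E) : ℝ :=
  ((2 * Real.pi) ^ (Module.finrank ℝ E / 2 : ℝ))⁻¹ * Real.exp (-(1 / 2) * ‖z‖ ^ 2)

theorem stdDensity_pos (z : E) : 0 < stdDensity E z := by
  unfold stdDensity; positivity

theorem continuous_stdDensity : Continuous (stdDensity E) := by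
  unfold stdDensity; fun_prop

theorem integrable_stdDensity : Integrable (stdDensity E) := by
  have := (GaussianFourier.integrable_cexp_neg_mul_sq_norm_add (V := E) (b := (1 / 2 : ℂ))
    (by norm_num) 0 0).norm
  refine Integrable.const_mul ?_ _
  refine this.congr (Eventually.of_forall fun z => ?_)
  simp only [Complex.norm_exp]
  congr 1
  simp [← Complex.ofReal_pow]

/-- Both finite measures have the same characteristic function, by the Fourier transform of a
Gaussian. -/
theorem stdGaussian_eq_withDensity :
    stdGaussian E = volume.withDensity (fun z => ENNReal.ofReal (stdDensity E z)) := by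
  have : IsFiniteMeasure (volume.withDensity (fun z => ENNReal.ofReal (stdDensity E z))) :=
    isFiniteMeasure_withDensity_ofReal integrable_stdDensity.2
  apply Measure.ext_of_charFun
  ext t
  rw [charFun_stdGaussian, charFun_apply, integral_withDensity_eq_integral_toReal_smul
    (by have := continuous_stdDensity (E := E); fun_prop) (by simp)]
  have key := GaussianFourier.integral_cexp_neg_mul_sq_norm_add (V := E) (b := (1 / 2 : ℂ))
    (by norm_num) Complex.I t
  have e : ∀ z : E, (ENNReal.ofReal (stdDensity E z)).toReal • Complex.exp (⟪z, t⟫ * Complex.I)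
      = (((2 * Real.pi) ^ (Module.finrank ℝ E / 2 : ℝ))⁻¹ : ℝ) *
        Complex.exp (-(1 / 2) * ‖z‖ ^ 2 + Complex.I * ⟪t, z⟫) := by
    intro z
    rw [ENNReal.toReal_ofReal (stdDensity_pos z).le, stdDensity, Complex.exp_add,
      real_inner_comm, Complex.real_smul]
    push_cast
    ring_nf
  simp_rw [e]
  rw [integral_const_mul, key]
  have e2 : ((Real.pi : ℂ) / (1 / 2)) ^ (Module.finrank ℝ E / 2 : ℂ)
      = (((2 * Real.pi) ^ (Module.finrank ℝ E / 2 : ℝ) : ℝ) : ℂ) := by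
    rw [Complex.ofReal_cpow (by positivity)]
    push_cast
    congr 1
    ring
  rw [e2, ← mul_assoc, ← Complex.ofReal_mul, inv_mul_cancel₀ (by positivity)]
  simp only [Complex.ofReal_one, one_mul, Complex.I_sq]
  congr 1
  ring

theorem stdGaussian_absolutelyContinuous : stdGaussian E ≪ volume := by
  rw [stdGaussian_eq_withDensity]
  exact withDensity_absolutelyContinuous _ _

theorem integral_stdGaussian_eq (u : E → ℝ) :
    ∫ z, u z ∂(stdGaussian E) = ∫ z, stdDensity E z * u z := by
  rw [stdGaussian_eq_withDensity, integral_withDensity_eq_integral_toReal_smul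
    (by have := continuous_stdDensity (E := E); fun_prop) (by simp)]
  simp_rw [ENNReal.toReal_ofReal (stdDensity_pos _).le, smul_eq_mul]

theorem integrable_stdGaussian_iff (u : E → ℝ) :
    Integrable u (stdGaussian E) ↔ Integrable (fun z => stdDensity E z * u z) := by
  rw [stdGaussian_eq_withDensity, integrable_withDensity_iff_integrable_smul'
    (by have := continuous_stdDensity (E := E); fun_prop) (by simp)]
  simp_rw [ENNReal.toReal_ofReal (stdDensity_pos _).le, smul_eq_mul]

theorem hasFDerivAt_stdDensity (z : E) :
    HasFDerivAt (stdDensity E) (-(stdDensity E z) • innerSL ℝ z) z := by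
  have h := (((hasStrictFDerivAt_norm_sq z).hasFDerivAt.const_mul (-(1 / 2 : ℝ))).exp).const_mul
    (((2 * Real.pi) ^ (Module.finrank ℝ E / 2 : ℝ))⁻¹)
  refine h.congr_fderiv ?_
  ext v
  simp [stdDensity]
  ring

/-- **Stein's lemma** in the direction `v`. -/
theorem integral_mul_inner_stdGaussian {u : E → ℝ} {u' : E → E →L[ℝ] ℝ}
    (hd : ∀ z, HasFDerivAt u (u' z) z) (hu : Tame u) (hu' : Tame u') (v : E) :
    ∫ z, u z * ⟪z, v⟫ ∂(stdGaussian E) = ∫ z, u' z v ∂(stdGaussian E) := by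
  have t1 : Integrable (fun z => u z * ⟪z, v⟫) (stdGaussian E) :=
    (hu.mul (Tame.id'.inner (.const v))).integrable _
  have t2 : Integrable (fun z => u' z v) (stdGaussian E) := (hu'.apply (.const v)).integrable _
  have t3 := hu.integrable (stdGaussian E)
  rw [integrable_stdGaussian_iff] at t1 t2 t3
  rw [integral_stdGaussian_eq, integral_stdGaussian_eq]
  have e1 : ∀ z, fderiv ℝ (stdDensity E) z v = -(stdDensity E z * ⟪z, v⟫) := fun z => by
    rw [(hasFDerivAt_stdDensity z).fderiv]; simp
  have e2 : ∀ z, fderiv ℝ u z = u' z := fun z => (hd z).fderiv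
  -- Integration by parts for Lebesgue measure: differentiating the density brings down the factor
  -- `-⟪z, v⟫`.
  have key := integral_mul_fderiv_eq_neg_fderiv_mul_of_integrable (μ := (volume : Measure E))
    (f := stdDensity E) (g := u) (v := v)
    (by simp_rw [e1]; refine t1.neg.congr (Eventually.of_forall fun z => ?_); simp; ring)
    (by simp_rw [e2]; exact t2) t3
    (fun z _ => (hasFDerivAt_stdDensity z).differentiableAt)
    (fun z _ => (hd z).differentiableAt)
  simp_rw [e1, e2] at key
  rw [key, ← integral_neg]
  congr 1 with z
  ring

end Stein

/-! ### Second order Stein identity and Poincaré inequality, smooth case. -/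

section SecondOrder

variable {E : Type*} [NormedAddCommGroup E] [InnerProductSpace ℝ E] [FiniteDimensional ℝ E]

variable (E) in
/-- The trace, as a continuous linear form on endomorphisms. -/
noncomputable def traceL : (E →L[ℝ] E) →L[ℝ] ℝ :=
  LinearMap.toContinuousLinearMap
    ((LinearMap.trace ℝ E) ∘ₗ (ContinuousLinearMap.coeLM ℝ : (E →L[ℝ] E) →ₗ[ℝ] (E →ₗ[ℝ] E)))

theorem traceL_apply (A : E →L[ℝ] E) : traceL E A = LinearMap.trace ℝ E (A : E →ₗ[ℝ] E) := rfl

theorem traceL_eq_sum {ι : Type*} [Fintype ι] (b : OrthonormalBasis ι ℝ E) (A : E →L[ℝ] E) :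
    traceL E A = ∑ i, ⟪b i, A (b i)⟫ := by
  rw [traceL_apply, LinearMap.trace_eq_sum_inner _ b]; rfl

variable [MeasurableSpace E] [BorelSpace E]

/-- Integration by parts against the Gaussian divergence of a vector field. -/
theorem integral_mul_divergence_stdGaussian {h : E → ℝ} {h' : E → E →L[ℝ] ℝ}
    {g : E → E} {g' : E → E →L[ℝ] E}
    (hh : ∀ z, HasFDerivAt h (h' z) z) (hg : ∀ z, HasFDerivAt g (g' z) z)
    (th : Tame h) (th' : Tame h') (tg : Tame g) (tg' : Tame g') :
    ∫ z, h z * (⟪z, g z⟫ - traceL E (g' z)) ∂(stdGaussian E) = ∫ z, h' z (g z) ∂(stdGaussian E) := by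
  let b := stdOrthonormalBasis ℝ E
  let u' : ∀ i, E → E →L[ℝ] ℝ := fun i z =>
    h z • ((innerSL ℝ (b i)).comp (g' z)) + ⟪b i, g z⟫ • h' z
  have hu : ∀ i z, HasFDerivAt (fun z => h z * ⟪b i, g z⟫) (u' i z) z := fun i z =>
    (hh z).mul (((innerSL ℝ (b i)).hasFDerivAt).comp z (hg z))
  have tu : ∀ i, Tame (fun z => h z * ⟪b i, g z⟫) := fun i => th.mul ((Tame.const _).inner tg)
  have tu' : ∀ i, Tame (u' i) := fun i =>
    (th.smul (.bilin (ContinuousLinearMap.compL ℝ E E ℝ) (.const _) tg')).add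
      (((Tame.const _).inner tg).smul th')
  -- Stein's lemma for each coordinate of `h g` in its own basis direction, then summed.
  have key : ∑ i, ∫ z, h z * ⟪b i, g z⟫ * ⟪z, b i⟫ ∂(stdGaussian E)
      = ∑ i, ∫ z, u' i z (b i) ∂(stdGaussian E) :=
    Finset.sum_congr rfl fun i _ => integral_mul_inner_stdGaussian (hu i) (tu i) (tu' i) (b i)
  rw [← integral_finsetSum _ fun i _ => ((tu i).mul (Tame.id'.inner (.const _))).integrable _,
    ← integral_finsetSum _ fun i _ => ((tu' i).apply (.const _)).integrable _] at key
  have e1 : ∀ z, ∑ i, h z * ⟪b i, g z⟫ * ⟪z, b i⟫ = h z * ⟪z, g z⟫ := fun z => by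
    rw [← b.sum_inner_mul_inner z (g z), Finset.mul_sum]
    exact Finset.sum_congr rfl fun i _ => by ring
  have e2 : ∀ z, ∑ i, u' i z (b i) = h z * traceL E (g' z) + h' z (g z) := fun z => by
    have : h' z (g z) = ∑ i, ⟪b i, g z⟫ * h' z (b i) := by
      conv_lhs => rw [← b.sum_repr' (g z)]
      simp
    rw [this, traceL_eq_sum b, Finset.mul_sum, ← Finset.sum_add_distrib]
    rfl
  simp_rw [e1, e2] at key
  have i1 := (th.mul (Tame.id'.inner tg)).integrable (stdGaussian E)
  have i2 := (th.mul ((Tame.clm (traceL E)).comp tg')).integrable (stdGaussian E)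
  rw [integral_add i2 ((th'.apply tg).integrable _)] at key
  simp_rw [mul_sub]
  rw [integral_sub i1 i2, key]
  ring

/-- The second order Stein identity for smooth vector fields. -/
theorem integral_divergence_sq_stdGaussian {g : E → E} {g' : E → E →L[ℝ] E}
    {g'' : E → E →L[ℝ] E →L[ℝ] E}
    (hg : ∀ z, HasFDerivAt g (g' z) z) (hg' : ∀ z, HasFDerivAt g' (g'' z) z)
    (tg : Tame g) (tg' : Tame g') (tg'' : Tame g'') :
    ∫ z, (⟪z, g z⟫ - traceL E (g' z)) ^ 2 ∂(stdGaussian E)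
      = ∫ z, (‖g z‖ ^ 2 + traceL E ((g' z).comp (g' z))) ∂(stdGaussian E) := by
  let d' : E → E →L[ℝ] ℝ := fun z =>
    ((innerSL ℝ z).comp (g' z) + (innerSL ℝ (g z))) - (traceL E).comp (g'' z)
  have td : Tame (fun z => ⟪z, g z⟫ - traceL E (g' z)) :=
    (Tame.id'.inner tg).sub ((Tame.clm _).comp tg')
  have td' : Tame d' := by
    refine ((Tame.bilin (ContinuousLinearMap.compL ℝ E E ℝ)
      ((Tame.clm (innerSL ℝ)).comp Tame.id') tg').add ((Tame.clm (innerSL ℝ)).comp tg)).sub ?_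
    exact (Tame.clm (ContinuousLinearMap.compL ℝ E (E →L[ℝ] E) ℝ (traceL E))).comp tg''
  have hd : ∀ z, HasFDerivAt (fun z => ⟪z, g z⟫ - traceL E (g' z)) (d' z) z := fun z => by
    refine HasFDerivAt.sub ?_ (((traceL E).hasFDerivAt).comp z (hg' z))
    refine ((hasFDerivAt_id z).inner ℝ (hg z)).congr_fderiv ?_
    ext v
    simp [real_inner_comm]
  have key1 := integral_mul_divergence_stdGaussian hd hg td td' tg tg'
  -- The divergence of the second field `z ↦ g' z (g z)` has mean zero and contains exactly the
  -- unwanted terms `⟪z, g' z (g z)⟫` and `tr g'' z (g z)` produced by `key1`.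
  let k' : E → E →L[ℝ] E := fun z => (g' z).comp (g' z) + (g'' z).flip (g z)
  have hk : ∀ z, HasFDerivAt (fun z => g' z (g z)) (k' z) z := fun z => (hg' z).clm_apply (hg z)
  have tk : Tame (fun z => g' z (g z)) := tg'.apply tg
  have tk' : Tame k' :=
    (Tame.bilin (ContinuousLinearMap.compL ℝ E E E) tg' tg').add
      (((Tame.clm (ContinuousLinearMap.flipₗᵢ ℝ E E E :
        (E →L[ℝ] E →L[ℝ] E) →L[ℝ] (E →L[ℝ] E →L[ℝ] E))).comp tg'').apply tg)
  have key2 := integral_mul_divergence_stdGaussian (h := fun _ : E => (1 : ℝ)) (h' := fun _ => 0)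
    (fun z => hasFDerivAt_const _ _) hk (.const _) (.const _) tk tk'
  simp only [one_mul, zero_apply, integral_zero] at key2
  have i1 := ((Tame.id'.inner tk).sub ((Tame.clm (traceL E)).comp tk')).integrable (stdGaussian E)
  have i2 : Integrable (fun z => ‖g z‖ ^ 2 + traceL E ((g' z).comp (g' z))) (stdGaussian E) :=
    ((tg.norm.pow 2).add ((Tame.clm (traceL E)).comp
      (Tame.bilin (ContinuousLinearMap.compL ℝ E E E) tg' tg'))).integrable _
  simp_rw [sq (⟪_, _⟫ - _)]
  rw [key1, ← add_zero (∫ z, (‖g z‖ ^ 2 + traceL E ((g' z).comp (g' z))) ∂(stdGaussian E)), ← key2,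
    ← integral_add i2 i1]
  congr 1 with z
  -- Symmetry of the second derivative makes the two traces of `g''` cancel.
  have hs : (g'' z).flip (g z) = g'' z (g z) := by
    ext w
    exact second_derivative_symmetric hg (hg' z) _ _
  have e : d' z (g z) = ⟪z, g' z (g z)⟫ + ⟪g z, g z⟫ - traceL E (g'' z (g z)) := rfl
  rw [e, real_inner_self_eq_norm_sq]
  simp only [k', hs, map_add]
  ring

theorem tame_rotation_fst (θ : ℝ) :
    Tame (fun p : E × E => Real.cos θ • p.1 + Real.sin θ • p.2) :=
  ((Tame.const _).smul (.clm (.fst ℝ E E))).add ((Tame.const _).smul (.clm (.snd ℝ E E)))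

/-- A pair of independent standard Gaussian vectors is invariant in law under rotation. -/
theorem integral_comp_rotation_stdGaussian {K : E × E → ℝ} (hK : Tame K) (θ : ℝ) :
    ∫ p, K (ContinuousLinearMap.rotation θ p) ∂((stdGaussian E).prod (stdGaussian E))
      = ∫ p, K p ∂((stdGaussian E).prod (stdGaussian E)) := by
  have hm := IsGaussian.map_rotation_eq_self (μ := stdGaussian E) (by simp) θ
  conv_rhs => rw [← hm]
  rw [integral_map (ContinuousLinearMap.rotation θ).continuous.aemeasurable
    hK.continuous.aestronglyMeasurable]

theorem integral_comp_rotation_fst_stdGaussian {k : E → ℝ} (hk : Tame k) (θ : ℝ) :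
    ∫ p : E × E, k (Real.cos θ • p.1 + Real.sin θ • p.2) ∂((stdGaussian E).prod (stdGaussian E))
      = ∫ z, k z ∂(stdGaussian E) := by
  have h1 : Tame (fun p : E × E => k p.1) := hk.comp (.clm (.fst ℝ E E))
  have := integral_comp_rotation_stdGaussian h1 θ
  simp only [ContinuousLinearMap.rotation_apply] at this
  rw [this, integral_prod _ (h1.integrable _)]
  simp

/-- The derivative of the interpolation `θ ↦ E[h(X) h(cos θ X + sin θ Y)]`, after a rotation and
an integration by parts. -/
theorem integral_mul_rotation_deriv {h : E → ℝ} {v : E → E}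
    (hh : ∀ z, HasFDerivAt h (innerSL ℝ (v z)) z) (th : Tame h) (tv : Tame v) (θ : ℝ) :
    ∫ p : E × E, h p.1 * ⟪v (Real.cos θ • p.1 + Real.sin θ • p.2),
        -Real.sin θ • p.1 + Real.cos θ • p.2⟫ ∂((stdGaussian E).prod (stdGaussian E))
      = -Real.sin θ * ∫ p : E × E, ⟪v (Real.cos (-θ) • p.1 + Real.sin (-θ) • p.2), v p.1⟫
          ∂((stdGaussian E).prod (stdGaussian E)) := by
  have tf : Tame (fun p : E × E => p.1) := .clm (.fst ℝ E E)
  have ts : Tame (fun p : E × E => p.2) := .clm (.snd ℝ E E)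
  -- In rotated coordinates the velocity `-sin θ X + cos θ Y` is the second component, so Stein's
  -- lemma applies to it with the first component frozen.
  have tK : Tame (fun p : E × E => h (Real.cos (-θ) • p.1 + Real.sin (-θ) • p.2) * ⟪p.2, v p.1⟫) :=
    (th.comp (tame_rotation_fst _)).mul (ts.inner (tv.comp tf))
  have tK' : Tame (fun p : E × E => -Real.sin θ *
      ⟪v (Real.cos (-θ) • p.1 + Real.sin (-θ) • p.2), v p.1⟫) :=
    (Tame.const _).mul ((tv.comp (tame_rotation_fst _)).inner (tv.comp tf))
  have h1 := integral_comp_rotation_stdGaussian tK θ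
  have e1 : ∀ p : E × E,
      h (Real.cos (-θ) • (ContinuousLinearMap.rotation θ p).1
        + Real.sin (-θ) • (ContinuousLinearMap.rotation θ p).2)
        * ⟪(ContinuousLinearMap.rotation θ p).2, v (ContinuousLinearMap.rotation θ p).1⟫
      = h p.1 * ⟪v (Real.cos θ • p.1 + Real.sin θ • p.2),
        -Real.sin θ • p.1 + Real.cos θ • p.2⟫ := fun p => by
    rw [ContinuousLinearMap.rotation_apply, real_inner_comm]
    congr 2
    simp only [Real.cos_neg, Real.sin_neg]
    have := Real.cos_sq_add_sin_sq θ
    calc _ = (Real.cos θ ^ 2 + Real.sin θ ^ 2) • p.1 := by module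
      _ = p.1 := by rw [this, one_smul]
  simp_rw [e1] at h1
  rw [h1, integral_prod _ (tK.integrable _), ← integral_const_mul,
    integral_prod _ (tK'.integrable _)]
  congr 1 with x
  -- The derivative in `y` at frozen `x`; its factor `sin (-θ)` is the one in the conclusion.
  let u' : E → E →L[ℝ] ℝ := fun y =>
    Real.sin (-θ) • innerSL ℝ (v (Real.cos (-θ) • x + Real.sin (-θ) • y))
  have ta : Tame (fun y : E => Real.cos (-θ) • x + Real.sin (-θ) • y) :=
    (Tame.const _).add ((Tame.const _).smul Tame.id')
  have hu : ∀ y, HasFDerivAt (fun y => h (Real.cos (-θ) • x + Real.sin (-θ) • y)) (u' y) y := by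
    intro y
    have hl : HasFDerivAt (fun y : E => Real.cos (-θ) • x + Real.sin (-θ) • y)
        (Real.sin (-θ) • ContinuousLinearMap.id ℝ E) y :=
      ((hasFDerivAt_id y).const_smul _).const_add _
    refine ((hh _).comp y hl).congr_fderiv ?_
    ext w
    simp [u']
  rw [integral_mul_inner_stdGaussian hu (th.comp ta) ((Tame.const _).smul ((Tame.clm (innerSL ℝ)).comp (tv.comp ta))) (v x)]
  congr 1 with y
  simp [u']

/-- Differentiation under the integral; since `|cos θ|` and `|sin θ|` are at most 1, polynomial
growth gives a dominating function independent of `θ`. -/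
theorem hasDerivAt_integral_mul_rotation {h : E → ℝ} {h' : E → E →L[ℝ] ℝ}
    (hh : ∀ z, HasFDerivAt h (h' z) z) (th : Tame h) (th' : Tame h') (θ : ℝ) :
    HasDerivAt (fun θ => ∫ p : E × E, h p.1 * h (Real.cos θ • p.1 + Real.sin θ • p.2)
        ∂((stdGaussian E).prod (stdGaussian E)))
      (∫ p : E × E, h p.1 * h' (Real.cos θ • p.1 + Real.sin θ • p.2)
        (-Real.sin θ • p.1 + Real.cos θ • p.2) ∂((stdGaussian E).prod (stdGaussian E))) θ := by
  obtain ⟨C, m, hC, hb⟩ := th'.growth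
  have tf : Tame (fun p : E × E => p.1) := .clm (.fst ℝ E E)
  have ts : Tame (fun p : E × E => p.2) := .clm (.snd ℝ E E)
  have hrot : ∀ (a b : ℝ) (p : E × E), |a| ≤ 1 → |b| ≤ 1 →
      ‖a • p.1 + b • p.2‖ ≤ ‖p.1‖ + ‖p.2‖ := fun a b p ha hb => by
    refine (norm_add_le _ _).trans ?_
    rw [norm_smul, norm_smul, Real.norm_eq_abs, Real.norm_eq_abs]
    exact add_le_add (mul_le_of_le_one_left (norm_nonneg _) ha)
      (mul_le_of_le_one_left (norm_nonneg _) hb)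
  have tS : Tame (fun p : E × E => ‖p.1‖ + ‖p.2‖) := tf.norm.add ts.norm
  refine (hasDerivAt_integral_of_dominated_loc_of_deriv_le (s := Set.univ)
    (F := fun θ (p : E × E) => h p.1 * h (Real.cos θ • p.1 + Real.sin θ • p.2))
    (F' := fun θ (p : E × E) => h p.1 * h' (Real.cos θ • p.1 + Real.sin θ • p.2)
        (-Real.sin θ • p.1 + Real.cos θ • p.2))
    (bound := fun p : E × E => ‖h p.1‖ * ((C * (1 + (‖p.1‖ + ‖p.2‖)) ^ m) * (‖p.1‖ + ‖p.2‖)))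
    univ_mem ?_ ?_ ?_ ?_ ?_ ?_).2
  · exact Eventually.of_forall fun θ =>
      ((th.comp tf).mul (th.comp (tame_rotation_fst θ))).continuous.aestronglyMeasurable
  · exact ((th.comp tf).mul (th.comp (tame_rotation_fst θ))).integrable _
  · exact ((th.comp tf).mul ((th'.comp (tame_rotation_fst θ)).apply
      (((Tame.const _).smul tf).add ((Tame.const _).smul ts)))).continuous.aestronglyMeasurable
  · refine Eventually.of_forall fun p θ _ => ?_
    rw [norm_mul]
    gcongr
    refine (ContinuousLinearMap.le_opNorm _ _).trans ?_
    gcongr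
    · refine (hb _).trans ?_
      gcongr
      exact hrot _ _ p (Real.abs_cos_le_one θ) (Real.abs_sin_le_one θ)
    · exact hrot _ _ p (by simpa using Real.abs_sin_le_one θ) (Real.abs_cos_le_one θ)
  · exact ((th.comp tf).norm.mul (((Tame.const C).mul
      (((Tame.const 1).add tS).pow m)).mul tS)).integrable _
  · refine Eventually.of_forall fun p θ _ => ?_
    have hl : HasDerivAt (fun θ : ℝ => Real.cos θ • p.1 + Real.sin θ • p.2)
        (-Real.sin θ • p.1 + Real.cos θ • p.2) θ :=
      ((Real.hasDerivAt_cos θ).smul_const p.1).add ((Real.hasDerivAt_sin θ).smul_const p.2)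
    exact ((hh _).comp_hasDerivAt θ hl).const_mul _

/-- The **Gaussian Poincaré inequality**. -/
theorem integral_sq_sub_sq_integral_le_stdGaussian {h : E → ℝ} {v : E → E}
    (hh : ∀ z, HasFDerivAt h (innerSL ℝ (v z)) z) (th : Tame h) (tv : Tame v) :
    ∫ z, h z ^ 2 ∂(stdGaussian E) - (∫ z, h z ∂(stdGaussian E)) ^ 2
      ≤ ∫ z, ‖v z‖ ^ 2 ∂(stdGaussian E) := by
  set π := (stdGaussian E).prod (stdGaussian E) with hπ
  set K := ∫ z, ‖v z‖ ^ 2 ∂(stdGaussian E) with hK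
  set Φ : ℝ → ℝ := fun θ => ∫ p : E × E, h p.1 * h (Real.cos θ • p.1 + Real.sin θ • p.2) ∂π with hΦ
  have tf : Tame (fun p : E × E => p.1) := .clm (.fst ℝ E E)
  have ts : Tame (fun p : E × E => p.2) := .clm (.snd ℝ E E)
  have hd := fun θ => hasDerivAt_integral_mul_rotation hh th
    ((Tame.clm (innerSL ℝ)).comp tv) θ
  simp only [innerSL_apply_apply] at hd
  have tk : Tame (fun z => ‖v z‖ ^ 2) := tv.norm.pow 2
  have tk1 : Tame (fun p : E × E => ‖v p.1‖ ^ 2) := tk.comp tf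
  have tk2 := fun θ => tk.comp (tame_rotation_fst (E := E) θ)
  -- By `⟪a, b⟫ ≤ (‖a‖² + ‖b‖²) / 2`, since both arguments of `v` are standard Gaussian.
  have hbound : ∀ θ : ℝ, ∫ p : E × E, ⟪v (Real.cos (-θ) • p.1 + Real.sin (-θ) • p.2), v p.1⟫ ∂π ≤ K := fun θ => by
    have e2 : K = ∫ p : E × E, (‖v (Real.cos (-θ) • p.1 + Real.sin (-θ) • p.2)‖ ^ 2
        + ‖v p.1‖ ^ 2) / 2 ∂π := by
      rw [integral_div, integral_add ((tk2 (-θ)).integrable _) (tk1.integrable _),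
        integral_comp_rotation_fst_stdGaussian tk, integral_prod _ (tk1.integrable _)]
      simp [K]
    rw [e2]
    refine integral_mono (Tame.integrable ?_ _) (Tame.integrable ?_ _) fun p => ?_
    · exact (tv.comp (tame_rotation_fst (-θ))).inner (tv.comp tf)
    · simpa only [div_eq_mul_inv] using (((tk2 (-θ)).add tk1).mul (Tame.const (2⁻¹ : ℝ)))
    · refine (le_abs_self _).trans ((abs_real_inner_le_norm _ _).trans ?_)
      nlinarith [sq_nonneg (‖v (Real.cos (-θ) • p.1 + Real.sin (-θ) • p.2)‖ - ‖v p.1‖)]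
  -- The interpolation runs from `E h²` at `0` to `(E h)²` at `π / 2`, with derivative at least `-K
  -- sin θ`; comparing with `K cos θ` gives the Poincaré constant 1.
  have hmono : MonotoneOn (fun θ => Φ θ - K * Real.cos θ) (Set.Icc 0 (Real.pi / 2)) := by
    have hd2 : ∀ θ, HasDerivAt (fun θ => Φ θ - K * Real.cos θ) _ θ := fun θ =>
      (hd θ).sub ((Real.hasDerivAt_cos θ).const_mul K)
    refine monotoneOn_of_deriv_nonneg (convex_Icc _ _)
      (fun θ _ => (hd2 θ).continuousAt.continuousWithinAt)
      (fun θ _ => (hd2 θ).differentiableAt.differentiableWithinAt) fun θ hθ => ?_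
    rw [interior_Icc] at hθ
    rw [(hd2 θ).deriv, integral_mul_rotation_deriv hh th tv]
    have hs : 0 ≤ Real.sin θ :=
      Real.sin_nonneg_of_nonneg_of_le_pi hθ.1.le (by linarith [hθ.2, Real.pi_pos])
    nlinarith [hbound θ]
  have h0 : Φ 0 = ∫ z, h z ^ 2 ∂(stdGaussian E) := by
    simp only [hΦ, Real.cos_zero, Real.sin_zero, one_smul, zero_smul, add_zero, ← sq]
    rw [integral_prod _ (((th.comp tf).pow 2).integrable _)]
    simp
  have h1 : Φ (Real.pi / 2) = (∫ z, h z ∂(stdGaussian E)) ^ 2 := by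
    simp only [hΦ, Real.cos_pi_div_two, Real.sin_pi_div_two, one_smul, zero_smul, zero_add]
    rw [hπ, integral_prod_mul, sq]
  have := hmono (Set.left_mem_Icc.2 (by positivity)) (Set.right_mem_Icc.2 (by positivity))
    (by positivity)
  simp only [h0, h1, Real.cos_zero, Real.cos_pi_div_two] at this
  linarith

/-- A variance bound for the sum of a function and of the divergence of a vector field. -/
theorem variance_add_divergence_le_stdGaussian {h : E → ℝ} {v : E → E}
    {g : E → E} {g' : E → E →L[ℝ] E} {g'' : E → E →L[ℝ] E →L[ℝ] E}
    (hh : ∀ z, HasFDerivAt h (innerSL ℝ (v z)) z)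
    (hg : ∀ z, HasFDerivAt g (g' z) z) (hg' : ∀ z, HasFDerivAt g' (g'' z) z)
    (th : Tame h) (tv : Tame v) (tg : Tame g) (tg' : Tame g') (tg'' : Tame g'') :
    ∫ z, (h z + (⟪z, g z⟫ - traceL E (g' z))) ^ 2 ∂(stdGaussian E)
        - (∫ z, h z ∂(stdGaussian E)) ^ 2
      ≤ ∫ z, (‖v z + g z‖ ^ 2 + traceL E ((g' z).comp (g' z))) ∂(stdGaussian E) := by
  have th' : Tame (fun z => innerSL ℝ (v z)) := (Tame.clm (innerSL ℝ)).comp tv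
  have hp := integral_sq_sub_sq_integral_le_stdGaussian hh th tv
  have hs := integral_divergence_sq_stdGaussian hg hg' tg tg' tg''
  have hc := integral_mul_divergence_stdGaussian hh hg th th' tg tg'
  simp only [innerSL_apply_apply] at hc
  have td : Tame (fun z => ⟪z, g z⟫ - traceL E (g' z)) :=
    (Tame.id'.inner tg).sub ((Tame.clm _).comp tg')
  have tt : Tame (fun z => traceL E ((g' z).comp (g' z))) := (Tame.clm (traceL E)).comp
    (Tame.bilin (ContinuousLinearMap.compL ℝ E E E) tg' tg')
  have e1 : ∀ z, (h z + (⟪z, g z⟫ - traceL E (g' z))) ^ 2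
      = h z ^ 2 + 2 * (h z * (⟪z, g z⟫ - traceL E (g' z))) + (⟪z, g z⟫ - traceL E (g' z)) ^ 2 :=
    fun z => by ring
  have e2 : ∀ z, ‖v z + g z‖ ^ 2 + traceL E ((g' z).comp (g' z))
      = ‖v z‖ ^ 2 + 2 * ⟪v z, g z⟫ + (‖g z‖ ^ 2 + traceL E ((g' z).comp (g' z))) := fun z => by
    rw [norm_add_sq_real]; ring
  have i1 : Integrable (fun z => 2 * (h z * (⟪z, g z⟫ - traceL E (g' z)))) (stdGaussian E) :=
    ((th.mul td).integrable _).const_mul 2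
  have i2 : Integrable (fun z => 2 * ⟪v z, g z⟫) (stdGaussian E) :=
    ((tv.inner tg).integrable _).const_mul 2
  have i3 := (th.pow 2).integrable (stdGaussian E)
  have i4 := (tv.norm.pow 2).integrable (stdGaussian E)
  simp_rw [e1, e2]
  rw [integral_add (by exact i3.add i1) ((td.pow 2).integrable _), integral_add i3 i1,
    integral_add (by exact i4.add i2) (((tg.norm.pow 2).add tt).integrable _), integral_add i4 i2,
    integral_const_mul, integral_const_mul, hs, hc]
  linarith

end SecondOrder

/-! ### Smooth approximation of Lipschitz maps. -/

section Mollification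

open scoped Convolution

variable {E : Type*} [NormedAddCommGroup E] [InnerProductSpace ℝ E] [FiniteDimensional ℝ E]
  [MeasurableSpace E] [BorelSpace E]

theorem locallyIntegrable_fderiv_of_lipschitz {G : E → E} {K : ℝ≥0} (hG : LipschitzWith K G) :
    LocallyIntegrable (fderiv ℝ G) (volume : Measure E) := by
  have hm : AEStronglyMeasurable (fderiv ℝ G) (volume : Measure E) :=
    (measurable_fderiv ℝ G).aestronglyMeasurable
  refine (locallyIntegrable_const (K : ℝ)).mono hm (Eventually.of_forall fun z => ?_)
  simpa using norm_fderiv_le_of_lipschitz ℝ hG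

/-- The derivative can fall on `G` itself: by Rademacher's theorem `G` is differentiable almost
everywhere, and the Lipschitz bound dominates the difference quotients. -/
theorem hasFDerivAt_normed_convolution_of_lipschitz {G : E → E} {K : ℝ≥0} (hG : LipschitzWith K G)
    (φ : ContDiffBump (0 : E)) (z : E) :
    HasFDerivAt (φ.normed volume ⋆[ContinuousLinearMap.lsmul ℝ ℝ, volume] G)
      ((φ.normed volume ⋆[ContinuousLinearMap.lsmul ℝ ℝ, volume] (fderiv ℝ G)) z) z := by
  have hd : ∀ᵐ t : E, DifferentiableAt ℝ G (z - t) :=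
    (quasiMeasurePreserving_sub_left (volume : Measure E) z).ae hG.ae_differentiableAt
  have hφ : Integrable (φ.normed (volume : Measure E)) := φ.integrable_normed
  have hφc : Continuous (φ.normed (volume : Measure E)) := φ.continuous_normed
  refine (hasFDerivAt_integral_of_dominated_loc_of_lip (s := Set.univ)
    (F := fun x t => ContinuousLinearMap.lsmul ℝ ℝ (φ.normed volume t) (G (x - t)))
    (F' := fun t => ContinuousLinearMap.lsmul ℝ ℝ (φ.normed volume t) (fderiv ℝ G (z - t)))
    (bound := fun t => φ.normed volume t * K)
    univ_mem ?_ ?_ ?_ ?_ (hφ.mul_const _) ?_).2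
  · refine Eventually.of_forall fun x => Continuous.aestronglyMeasurable ?_
    have := hG.continuous
    simp only [ContinuousLinearMap.lsmul_apply]
    fun_prop
  · have := hG.continuous
    refine Continuous.integrable_of_hasCompactSupport ?_ ?_
    · simp only [ContinuousLinearMap.lsmul_apply]
      fun_prop
    · exact φ.hasCompactSupport_normed.smul_right
  · have hm : StronglyMeasurable (fun t => fderiv ℝ G (z - t)) :=
      (measurable_fderiv ℝ G).stronglyMeasurable.comp_measurable (by fun_prop)
    exact (hφc.stronglyMeasurable.smul hm).aestronglyMeasurable
  · refine Eventually.of_forall fun t => LipschitzWith.lipschitzOnWith ?_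
    refine LipschitzWith.of_dist_le_mul fun x y => ?_
    have h0 : 0 ≤ φ.normed volume t := φ.nonneg_normed t
    simp only [ContinuousLinearMap.lsmul_apply, dist_smul₀, Real.coe_nnabs]
    rw [Real.norm_of_nonneg h0, abs_of_nonneg (by positivity), mul_assoc]
    gcongr
    simpa using hG.dist_le_mul (x - t) (y - t)
  · filter_upwards [hd] with t ht
    have h1 : HasFDerivAt (fun x => G (x - t)) (fderiv ℝ G (z - t)) z := by
      have := ht.hasFDerivAt.comp z ((hasFDerivAt_id z).sub_const t)
      rwa [ContinuousLinearMap.comp_id] at this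
    exact h1.const_smul _

theorem norm_normed_convolution_le {F : Type*} [NormedAddCommGroup F] [NormedSpace ℝ F]
    {u : E → F} {C : ℝ} (hu : ∀ z, ‖u z‖ ≤ C) (φ : ContDiffBump (0 : E)) (z : E) :
    ‖(φ.normed volume ⋆[ContinuousLinearMap.lsmul ℝ ℝ, volume] u) z‖ ≤ C := by
  have h1 : ∫ t : E, φ.normed volume t * C = C := by
    rw [integral_mul_const, φ.integral_normed, one_mul]
  rw [← h1]
  refine norm_integral_le_of_norm_le (φ.integrable_normed.mul_const C)
    (Eventually.of_forall fun t => ?_)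
  rw [ContinuousLinearMap.lsmul_apply, norm_smul, Real.norm_of_nonneg (φ.nonneg_normed t)]
  exact mul_le_mul_of_nonneg_left (hu _) (φ.nonneg_normed t)

/-- Here the derivative falls on the bump. The bound degenerates as the bump shrinks, which is
harmless: second derivatives are needed at each fixed scale but do not occur in the limiting
identities. -/
theorem tame_fderiv_normed_convolution {F : Type*} [NormedAddCommGroup F] [NormedSpace ℝ F]
    {u : E → F} {C : ℝ} (hu : ∀ z, ‖u z‖ ≤ C) (hl : LocallyIntegrable u (volume : Measure E))
    (φ : ContDiffBump (0 : E)) :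
    Tame (fderiv ℝ (φ.normed volume ⋆[ContinuousLinearMap.lsmul ℝ ℝ, volume] u)) := by
  have hc1 : ContDiff ℝ 1 (φ.normed (volume : Measure E)) := φ.contDiff_normed
  have hcs : HasCompactSupport (φ.normed (volume : Measure E)) := φ.hasCompactSupport_normed
  have hcd : ContDiff ℝ (1 : ℕ∞) (φ.normed volume ⋆[ContinuousLinearMap.lsmul ℝ ℝ, volume] u) :=
    hcs.contDiff_convolution_left _ hc1 hl
  have hi : Integrable (fderiv ℝ (φ.normed (volume : Measure E))) :=
    (hc1.continuous_fderiv one_ne_zero).integrable_of_hasCompactSupport (hcs.fderiv ℝ)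
  refine .of_le (hcd.continuous_fderiv one_ne_zero)
    (∫ t, ‖fderiv ℝ (φ.normed (volume : Measure E)) t‖ * C) 0 fun z => ?_
  rw [(hcs.hasFDerivAt_convolution_left (ContinuousLinearMap.lsmul ℝ ℝ) hc1 hl z).fderiv,
    pow_zero, mul_one]
  refine norm_integral_le_of_norm_le (hi.norm.mul_const C)
    (Eventually.of_forall fun t => ?_)
  have hC : 0 ≤ C := (norm_nonneg _).trans (hu 0)
  refine ContinuousLinearMap.opNorm_le_bound _ (by positivity) fun v => ?_
  rw [ContinuousLinearMap.precompL_apply, ContinuousLinearMap.lsmul_apply, norm_smul, mul_right_comm]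
  gcongr
  · exact ContinuousLinearMap.le_opNorm _ _
  · exact hu _

/-- A sequence of smooth approximations of the Lipschitz map `G`, whose derivatives converge. -/
structure SmoothApprox (K : ℝ≥0) (G : E → E) (g : ℕ → E → E) (g' : ℕ → E → E →L[ℝ] E)
    (g'' : ℕ → E → E →L[ℝ] E →L[ℝ] E) : Prop where
  hasFDerivAt : ∀ k z, HasFDerivAt (g k) (g' k z) z
  hasFDerivAt' : ∀ k z, HasFDerivAt (g' k) (g'' k z) z
  tame'' : ∀ k, Tame (g'' k)
  norm_le : ∀ k z, ‖g k z‖ ≤ (‖G 0‖ + K) + K * ‖z‖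
  norm_le' : ∀ k z, ‖g' k z‖ ≤ K
  tendsto : ∀ z, Tendsto (fun k => g k z) atTop (𝓝 (G z))
  tendsto' : ∀ᵐ z : E, Tendsto (fun k => g' k z) atTop (𝓝 (fderiv ℝ G z))

theorem norm_le_affine_of_lipschitz {G : E → E} {K : ℝ≥0} (hG : LipschitzWith K G) (z : E) :
    ‖G z‖ ≤ ‖G 0‖ + K * ‖z‖ := by
  have h1 := hG.dist_le_mul z 0
  rw [dist_eq_norm, dist_zero_right] at h1
  calc ‖G z‖ = ‖G 0 + (G z - G 0)‖ := by congr 1; abel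
    _ ≤ ‖G 0‖ + ‖G z - G 0‖ := norm_add_le _ _
    _ ≤ _ := by gcongr

theorem exists_smoothApprox {G : E → E} {K : ℝ≥0} (hG : LipschitzWith K G) :
    ∃ g g' g'', SmoothApprox K G g g' g'' := by
  let φ : ℕ → ContDiffBump (0 : E) := fun k =>
    -- Outer radius at most 1 keeps the mollification within `K` of `G`; the fixed ratio 2 of the
    -- radii is what almost everywhere convergence of the derivatives requires.
    ⟨1 / ((k : ℝ) + 2), 2 / ((k : ℝ) + 2), by positivity, by gcongr; norm_num⟩
  have hrO : ∀ k, (φ k).rOut = 2 / ((k : ℝ) + 2) := fun k => rfl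
  have hrI : ∀ k, (φ k).rIn = 1 / ((k : ℝ) + 2) := fun k => rfl
  have hφ : Tendsto (fun k => (φ k).rOut) atTop (𝓝 0) := by
    simp_rw [hrO]
    exact tendsto_const_nhds.div_atTop
      (tendsto_atTop_add_const_right _ _ tendsto_natCast_atTop_atTop)
  have hb : ∀ z, ‖fderiv ℝ G z‖ ≤ (K : ℝ) := fun z => norm_fderiv_le_of_lipschitz ℝ hG
  have hli := locallyIntegrable_fderiv_of_lipschitz hG
  refine ⟨fun k => (φ k).normed volume ⋆[ContinuousLinearMap.lsmul ℝ ℝ, volume] G,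
    fun k => (φ k).normed volume ⋆[ContinuousLinearMap.lsmul ℝ ℝ, volume] (fderiv ℝ G),
    fun k => fderiv ℝ ((φ k).normed volume ⋆[ContinuousLinearMap.lsmul ℝ ℝ, volume] (fderiv ℝ G)),
    fun k z => hasFDerivAt_normed_convolution_of_lipschitz hG _ _, fun k z => ?_,
    fun k => tame_fderiv_normed_convolution hb hli _, fun k z => ?_,
    fun k z => norm_normed_convolution_le hb _ _,
    fun z => ContDiffBump.convolution_tendsto_right_of_continuous hφ hG.continuous z,
    ContDiffBump.ae_convolution_tendsto_right_of_locallyIntegrable (K := 2) hφ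
      (Eventually.of_forall fun k => ?_) hli⟩
  · have hcs : HasCompactSupport ((φ k).normed (volume : Measure E)) := (φ k).hasCompactSupport_normed
    exact (hcs.hasFDerivAt_convolution_left (ContinuousLinearMap.lsmul ℝ ℝ)
      (φ k).contDiff_normed hli z).differentiableAt.hasFDerivAt
  · have h1 : dist (((φ k).normed volume ⋆[ContinuousLinearMap.lsmul ℝ ℝ, volume] G : E → E) z)
        (G z) ≤ K := by
      refine (φ k).dist_normed_convolution_le hG.continuous.aestronglyMeasurable
        fun x hx => (hG.dist_le_mul x z).trans (mul_le_of_le_one_right K.2 ?_)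
      refine (Metric.mem_ball.1 hx).le.trans ?_
      rw [hrO, div_le_one (by positivity)]
      linarith [(Nat.cast_nonneg k : (0 : ℝ) ≤ k)]
    rw [dist_eq_norm] at h1
    have h2 := norm_le_affine_of_lipschitz hG z
    have h3 := norm_le_norm_add_norm_sub (G z)
      (((φ k).normed volume ⋆[ContinuousLinearMap.lsmul ℝ ℝ, volume] G : E → E) z)
    rw [norm_sub_rev] at h3
    linarith
  · rw [hrO, hrI]
    exact le_of_eq (by ring)

end Mollification

/-! ### Stein identities and variance bound for Lipschitz fields. -/

section LipschitzFields

variable {E : Type*} [NormedAddCommGroup E] [InnerProductSpace ℝ E] [FiniteDimensional ℝ E]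
  [MeasurableSpace E] [BorelSpace E]

/-- One dominating function serves all approximants, since they share the same affine growth and
derivative bounds. -/
theorem Tame.le_of_norm_le {Ψ : E × E × (E →L[ℝ] E) → ℝ} (hΨ : Tame Ψ) (c K : ℝ) (hc : 0 ≤ c)
    (hK : 0 ≤ K) :
    ∃ B : E → ℝ, Tame B ∧ ∀ z x A, ‖x‖ ≤ c + K * ‖z‖ → ‖A‖ ≤ K → ‖Ψ (z, x, A)‖ ≤ B z := by
  obtain ⟨C, m, hC, hb⟩ := hΨ.growth
  refine ⟨fun z => C * (1 + (c + K + (K + 1) * ‖z‖)) ^ m, ?_, fun z x A hx hA => ?_⟩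
  · exact (Tame.const C).mul (((Tame.const 1).add
      ((Tame.const (c + K)).add ((Tame.const (K + 1)).mul Tame.id'.norm))).pow m)
  · refine (hb _).trans ?_
    dsimp only
    gcongr
    have h1 : 0 ≤ K * ‖z‖ := by positivity
    simp only [Prod.norm_mk, sup_le_iff]
    have := norm_nonneg z
    refine ⟨by linarith, by linarith, by linarith⟩

theorem integrable_comp_of_lipschitz {G : E → E} {K : ℝ≥0} (hG : LipschitzWith K G)
    {Ψ : E × E × (E →L[ℝ] E) → ℝ} (hΨ : Tame Ψ) :
    Integrable (fun z => Ψ (z, G z, fderiv ℝ G z)) (stdGaussian E) := by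
  obtain ⟨B, hB, h⟩ := hΨ.le_of_norm_le ‖G 0‖ K (norm_nonneg _) K.2
  have hm : StronglyMeasurable (fun z => fderiv ℝ G z) := (measurable_fderiv ℝ G).stronglyMeasurable
  have hGm : StronglyMeasurable G := hG.continuous.stronglyMeasurable
  refine (hB.integrable (stdGaussian E)).mono' ?_ (Eventually.of_forall fun z =>
    h z _ _ (norm_le_affine_of_lipschitz hG z) (norm_fderiv_le_of_lipschitz ℝ hG))
  exact (hΨ.continuous.comp_stronglyMeasurable
    (stronglyMeasurable_id.prodMk (hGm.prodMk hm))).aestronglyMeasurable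

/-- The passage to the limit: dominated convergence for any functional of `(z, G z, DG z)` of
polynomial growth. Lebesgue-almost everywhere convergence suffices as the Gaussian measure is
absolutely continuous. -/
theorem SmoothApprox.tendsto_integral {G : E → E} {K : ℝ≥0} {g : ℕ → E → E}
    {g' : ℕ → E → E →L[ℝ] E} {g'' : ℕ → E → E →L[ℝ] E →L[ℝ] E}
    (S : SmoothApprox K G g g' g'') {Ψ : E × E × (E →L[ℝ] E) → ℝ} (hΨ : Tame Ψ) :
    Tendsto (fun k => ∫ z, Ψ (z, g k z, g' k z) ∂(stdGaussian E)) atTop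
      (𝓝 (∫ z, Ψ (z, G z, fderiv ℝ G z) ∂(stdGaussian E))) := by
  obtain ⟨B, hB, h⟩ := hΨ.le_of_norm_le (‖G 0‖ + K) K (by positivity) K.2
  refine tendsto_integral_of_dominated_convergence B (fun k => ?_) (hB.integrable _)
    (fun k => Eventually.of_forall fun z => h z _ _ (S.norm_le k z) (S.norm_le' k z)) ?_
  · refine Continuous.aestronglyMeasurable (hΨ.continuous.comp ?_)
    have h1 : Continuous (g k) :=
      continuous_iff_continuousAt.2 fun z => (S.hasFDerivAt k z).continuousAt
    have h2 : Continuous (g' k) :=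
      continuous_iff_continuousAt.2 fun z => (S.hasFDerivAt' k z).continuousAt
    fun_prop
  · filter_upwards [stdGaussian_absolutelyContinuous.ae_le S.tendsto'] with z hz
    exact (hΨ.continuous.tendsto _).comp
      (tendsto_const_nhds.prodMk_nhds ((S.tendsto z).prodMk_nhds hz))

theorem SmoothApprox.tame {G : E → E} {K : ℝ≥0} {g : ℕ → E → E}
    {g' : ℕ → E → E →L[ℝ] E} {g'' : ℕ → E → E →L[ℝ] E →L[ℝ] E}
    (S : SmoothApprox K G g g' g'') (k : ℕ) : Tame (g k) :=
  .of_le (continuous_iff_continuousAt.2 fun z => (S.hasFDerivAt k z).continuousAt)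
    (‖G 0‖ + K + K) 1 fun z => (S.norm_le k z).trans (by
      have := mul_nonneg (norm_nonneg (G 0)) (norm_nonneg z)
      have := mul_nonneg K.2 (norm_nonneg z)
      have := K.2
      simp only [NNReal.val_eq_coe] at *
      nlinarith)

theorem SmoothApprox.tame' {G : E → E} {K : ℝ≥0} {g : ℕ → E → E}
    {g' : ℕ → E → E →L[ℝ] E} {g'' : ℕ → E → E →L[ℝ] E →L[ℝ] E}
    (S : SmoothApprox K G g g' g'') (k : ℕ) : Tame (g' k) :=
  .of_le (continuous_iff_continuousAt.2 fun z => (S.hasFDerivAt' k z).continuousAt)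
    K 0 fun z => by simpa using S.norm_le' k z

/-- The functional `⟪z, p x + q z⟫ - tr (p A + q)`, the divergence of the field `p G + q id` at
`x = G z` and `A = DG z`. -/
noncomputable def divFun (p q : ℝ) (t : E × E × (E →L[ℝ] E)) : ℝ :=
  ⟪t.1, p • t.2.1 + q • t.1⟫ - traceL E (p • t.2.2 + q • ContinuousLinearMap.id ℝ E)

/-- The functional `‖p x + q z‖² + tr ((p A + q)²)`. -/
noncomputable def sqFun (p q : ℝ) (t : E × E × (E →L[ℝ] E)) : ℝ :=
  ‖p • t.2.1 + q • t.1‖ ^ 2 + traceL E ((p • t.2.2 + q • ContinuousLinearMap.id ℝ E).comp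
    (p • t.2.2 + q • ContinuousLinearMap.id ℝ E))

/-- The quadratic functional `a ‖x‖² + b ⟪z, x⟫ + c ‖z‖²`. -/
noncomputable def quadFun (a b c : ℝ) (t : E × E × (E →L[ℝ] E)) : ℝ :=
  a * ‖t.2.1‖ ^ 2 + b * ⟪t.1, t.2.1⟫ + c * ‖t.1‖ ^ 2

/-- The gradient of `a ‖G‖² + b ⟪z, G⟫ + c ‖z‖²`. -/
noncomputable def quadGrad (a b c : ℝ) (t : E × E × (E →L[ℝ] E)) : E :=
  (2 * a) • ContinuousLinearMap.adjoint t.2.2 t.2.1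
    + b • (ContinuousLinearMap.adjoint t.2.2 t.1 + t.2.1) + (2 * c) • t.1

/-- The functional `‖∇h + g‖² + tr ((Dg)²)` for `h = a ‖G‖² + b ⟪z, G⟫ + c ‖z‖²` and
`g = p G + q id`. -/
noncomputable def boundFun (a b c p q : ℝ) (t : E × E × (E →L[ℝ] E)) : ℝ :=
  ‖quadGrad a b c t + (p • t.2.1 + q • t.1)‖ ^ 2
    + traceL E ((p • t.2.2 + q • ContinuousLinearMap.id ℝ E).comp
      (p • t.2.2 + q • ContinuousLinearMap.id ℝ E))

section

theorem tame_z : Tame (fun t : E × E × (E →L[ℝ] E) => t.1) := 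
  Tame.clm (ContinuousLinearMap.fst ℝ E (E × (E →L[ℝ] E)))

theorem tame_x : Tame (fun t : E × E × (E →L[ℝ] E) => t.2.1) :=
  Tame.clm ((ContinuousLinearMap.fst ℝ E (E →L[ℝ] E)).comp
    (ContinuousLinearMap.snd ℝ E (E × (E →L[ℝ] E))))

theorem tame_A : Tame (fun t : E × E × (E →L[ℝ] E) => t.2.2) :=
  Tame.clm ((ContinuousLinearMap.snd ℝ E (E →L[ℝ] E)).comp
    (ContinuousLinearMap.snd ℝ E (E × (E →L[ℝ] E))))

theorem tame_adjoint : Tame (fun t : E × E × (E →L[ℝ] E) => ContinuousLinearMap.adjoint t.2.2) :=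
  Tame.comp (u := fun A : E →L[ℝ] E => ContinuousLinearMap.adjoint A)
    (.of_le (LinearIsometryEquiv.continuous _) 1 1 fun A => by
      rw [LinearIsometryEquiv.norm_map]; simp) tame_A

theorem tame_field (p q : ℝ) : Tame (fun t : E × E × (E →L[ℝ] E) => p • t.2.1 + q • t.1) :=
  ((Tame.const _).smul tame_x).add ((Tame.const _).smul tame_z)

theorem tame_fieldDeriv (p q : ℝ) :
    Tame (fun t : E × E × (E →L[ℝ] E) => p • t.2.2 + q • ContinuousLinearMap.id ℝ E) :=
  ((Tame.const _).smul tame_A).add (.const _)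

theorem tame_divFun (p q : ℝ) : Tame (divFun (E := E) p q) :=
  (tame_z.inner (tame_field p q)).sub ((Tame.clm (traceL E)).comp (tame_fieldDeriv p q))

theorem tame_traceSq (p q : ℝ) :
    Tame (fun t : E × E × (E →L[ℝ] E) =>
      traceL E ((p • t.2.2 + q • ContinuousLinearMap.id ℝ E).comp
        (p • t.2.2 + q • ContinuousLinearMap.id ℝ E))) :=
  (Tame.clm (traceL E)).comp
    (Tame.bilin (ContinuousLinearMap.compL ℝ E E E) (tame_fieldDeriv p q) (tame_fieldDeriv p q))

theorem tame_sqFun (p q : ℝ) : Tame (sqFun (E := E) p q) :=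
  ((tame_field p q).norm.pow 2).add (tame_traceSq p q)

theorem tame_quadFun (a b c : ℝ) : Tame (quadFun (E := E) a b c) :=
  (((Tame.const a).mul (tame_x.norm.pow 2)).add ((Tame.const b).mul (tame_z.inner tame_x))).add
    ((Tame.const c).mul (tame_z.norm.pow 2))

theorem tame_quadGrad (a b c : ℝ) : Tame (quadGrad (E := E) a b c) :=
  (((Tame.const (2 * a)).smul (tame_adjoint.apply tame_x)).add
    ((Tame.const b).smul ((tame_adjoint.apply tame_z).add tame_x))).add
    ((Tame.const (2 * c)).smul tame_z)

theorem tame_boundFun (a b c p q : ℝ) : Tame (boundFun (E := E) a b c p q) :=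
  (((tame_quadGrad a b c).add (tame_field p q)).norm.pow 2).add (tame_traceSq p q)

theorem hasFDerivAt_quadFun {G : E → E} {z : E} {A : E →L[ℝ] E} (h : HasFDerivAt G A z)
    (a b c : ℝ) :
    HasFDerivAt (fun z => a * ‖G z‖ ^ 2 + b * ⟪z, G z⟫ + c * ‖z‖ ^ 2)
      (innerSL ℝ (quadGrad a b c (z, G z, A))) z := by
  have h1 := (h.norm_sq.const_mul a).add (((hasFDerivAt_id z).inner ℝ h).const_mul b)
  have h2 := h1.add ((hasFDerivAt_id z).norm_sq.const_mul c)
  refine h2.congr_fderiv ?_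
  ext w
  simp only [quadGrad, add_apply, smul_apply, innerSL_apply_apply, ContinuousLinearMap.comp_apply,
    inner_add_left, inner_smul_left, ContinuousLinearMap.adjoint_inner_left, smul_eq_mul,
    fderivInnerCLM_apply, ContinuousLinearMap.prod_apply, ContinuousLinearMap.id_apply, id]
  simp [real_inner_comm]
  ring

theorem hasFDerivAt_field {G : E → E} {z : E} {A : E →L[ℝ] E} (h : HasFDerivAt G A z) (p q : ℝ) :
    HasFDerivAt (fun z => p • G z + q • z) (p • A + q • ContinuousLinearMap.id ℝ E) z :=
  (h.const_smul p).add ((hasFDerivAt_id z).const_smul q)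

end

/-- The divergence of a Lipschitz field is centered under the standard Gaussian measure. -/
theorem integral_divFun {G : E → E} {K : ℝ≥0} (hG : LipschitzWith K G) (p q : ℝ) :
    ∫ z, divFun p q (z, G z, fderiv ℝ G z) ∂(stdGaussian E) = 0 := by
  obtain ⟨g, g', g'', S⟩ := exists_smoothApprox hG
  refine tendsto_nhds_unique (S.tendsto_integral (tame_divFun p q)) ?_
  refine tendsto_const_nhds.congr fun k => ?_
  have tg : Tame (fun z => p • g k z + q • z) :=
    ((Tame.const _).smul (S.tame k)).add ((Tame.const _).smul Tame.id')
  have tg' : Tame (fun z => p • g' k z + q • ContinuousLinearMap.id ℝ E) :=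
    ((Tame.const _).smul (S.tame' k)).add (.const _)
  have := integral_mul_divergence_stdGaussian (h := fun _ : E => (1 : ℝ)) (h' := fun _ => 0)
    (fun z => hasFDerivAt_const _ _) (fun z => hasFDerivAt_field (S.hasFDerivAt k z) p q)
    (.const _) (.const _) tg tg'
  simp only [one_mul, zero_apply, integral_zero] at this
  exact this.symm

/-- The second order Stein identity for Lipschitz fields. -/
theorem integral_divFun_sq {G : E → E} {K : ℝ≥0} (hG : LipschitzWith K G) (p q : ℝ) :
    ∫ z, divFun p q (z, G z, fderiv ℝ G z) ^ 2 ∂(stdGaussian E)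
      = ∫ z, sqFun p q (z, G z, fderiv ℝ G z) ∂(stdGaussian E) := by
  obtain ⟨g, g', g'', S⟩ := exists_smoothApprox hG
  refine tendsto_nhds_unique (S.tendsto_integral ((tame_divFun p q).pow 2)) ?_
  refine (S.tendsto_integral (tame_sqFun p q)).congr fun k => ?_
  have tg : Tame (fun z => p • g k z + q • z) :=
    ((Tame.const _).smul (S.tame k)).add ((Tame.const _).smul Tame.id')
  have tg' : Tame (fun z => p • g' k z + q • ContinuousLinearMap.id ℝ E) :=
    ((Tame.const _).smul (S.tame' k)).add (.const _)
  have tg'' : Tame (fun z => p • g'' k z) := (Tame.const _).smul (S.tame'' k)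
  exact (integral_divergence_sq_stdGaussian (fun z => hasFDerivAt_field (S.hasFDerivAt k z) p q)
    (fun z => ((S.hasFDerivAt' k z).const_smul p).add_const _) tg tg' tg'').symm

/-- The variance bound for the sum of a quadratic functional and of a divergence. -/
theorem variance_quadFun_add_divFun_le {G : E → E} {K : ℝ≥0} (hG : LipschitzWith K G)
    (a b c p q : ℝ) :
    ∫ z, (quadFun a b c (z, G z, fderiv ℝ G z) + divFun p q (z, G z, fderiv ℝ G z)) ^ 2
          ∂(stdGaussian E)
        - (∫ z, quadFun a b c (z, G z, fderiv ℝ G z) ∂(stdGaussian E)) ^ 2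
      ≤ ∫ z, boundFun a b c p q (z, G z, fderiv ℝ G z) ∂(stdGaussian E) := by
  obtain ⟨g, g', g'', S⟩ := exists_smoothApprox hG
  refine le_of_tendsto_of_tendsto'
    ((S.tendsto_integral (((tame_quadFun a b c).add (tame_divFun p q)).pow 2)).sub
      ((S.tendsto_integral (tame_quadFun a b c)).pow 2))
    (S.tendsto_integral (tame_boundFun a b c p q)) fun k => ?_
  have tp : Tame (fun z => (z, g k z, g' k z)) := by
    have h1 := (S.tame k)
    have h2 := S.tame' k
    have e1 : Tame (fun z : E => ContinuousLinearMap.inl ℝ E (E × (E →L[ℝ] E)) z) := Tame.clm _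
    have e2 : Tame (fun z : E => (ContinuousLinearMap.inr ℝ E (E × (E →L[ℝ] E)))
      (ContinuousLinearMap.inl ℝ E (E →L[ℝ] E) (g k z))) := (Tame.clm _).comp ((Tame.clm _).comp h1)
    have e3 : Tame (fun z : E => (ContinuousLinearMap.inr ℝ E (E × (E →L[ℝ] E)))
      (ContinuousLinearMap.inr ℝ E (E →L[ℝ] E) (g' k z))) :=
      (Tame.clm _).comp ((Tame.clm _).comp h2)
    simpa using e1.add (e2.add e3)
  exact variance_add_divergence_le_stdGaussian
    (fun z => hasFDerivAt_quadFun (S.hasFDerivAt k z) a b c)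
    (fun z => hasFDerivAt_field (S.hasFDerivAt k z) p q)
    (fun z => ((S.hasFDerivAt' k z).const_smul p).add_const _)
    ((tame_quadFun a b c).comp tp) ((tame_quadGrad a b c).comp tp)
    ((tame_field p q).comp tp) ((tame_fieldDeriv p q).comp tp)
    ((Tame.const _).smul (S.tame'' k))

end LipschitzFields

/-! ### Risk identities when the derivative is an orthogonal projection. -/

section Projections

variable {E : Type*} [NormedAddCommGroup E] [InnerProductSpace ℝ E] [FiniteDimensional ℝ E]

theorem traceL_id : traceL E (ContinuousLinearMap.id ℝ E) = Module.finrank ℝ E := by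
  rw [traceL_apply]
  exact LinearMap.trace_id ℝ E

theorem divFun_eq (p q : ℝ) (z x : E) (A : E →L[ℝ] E) :
    divFun p q (z, x, A)
      = p * ⟪z, x⟫ + q * ‖z‖ ^ 2 - (p * traceL E A + q * Module.finrank ℝ E) := by
  simp only [divFun, inner_add_right, inner_smul_right, real_inner_self_eq_norm_sq, map_add,
    map_smul, traceL_id, smul_eq_mul]

/-- `I - 2A` is an involution when `A` is idempotent, so the trace of its square is the dimension.
-/
theorem sqFun_eq_of_idempotent {A : E →L[ℝ] E} (hi : A.comp A = A) (z x : E) :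
    sqFun (-2) 1 (z, x, A) = ‖(2 : ℝ) • x - z‖ ^ 2 + Module.finrank ℝ E := by
  have h1 : ((-2 : ℝ) • A + (1 : ℝ) • ContinuousLinearMap.id ℝ E).comp
      ((-2 : ℝ) • A + (1 : ℝ) • ContinuousLinearMap.id ℝ E) = ContinuousLinearMap.id ℝ E := by
    ext w
    have : ∀ w, A (A w) = A w := fun w => congrArg (fun B : E →L[ℝ] E => B w) hi
    simp only [ContinuousLinearMap.comp_apply, add_apply, smul_apply, map_add, map_smul, this,
      ContinuousLinearMap.id_apply]
    module
  simp only [sqFun, h1, traceL_id]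
  congr 2
  rw [← norm_neg]
  congr 1
  module

theorem traceL_one_sub_sq {A : E →L[ℝ] E} (hi : A.comp A = A) :
    traceL E (((-1 : ℝ) • A + (1 : ℝ) • ContinuousLinearMap.id ℝ E).comp
      ((-1 : ℝ) • A + (1 : ℝ) • ContinuousLinearMap.id ℝ E))
      = Module.finrank ℝ E - traceL E A := by
  have h1 : ((-1 : ℝ) • A + (1 : ℝ) • ContinuousLinearMap.id ℝ E).comp
      ((-1 : ℝ) • A + (1 : ℝ) • ContinuousLinearMap.id ℝ E)
      = ContinuousLinearMap.id ℝ E - A := by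
    ext w
    have : ∀ w, A (A w) = A w := fun w => congrArg (fun B : E →L[ℝ] E => B w) hi
    simp only [ContinuousLinearMap.comp_apply, add_apply, smul_apply, map_add, map_smul, this,
      ContinuousLinearMap.id_apply, sub_apply]
    module
  rw [h1, map_sub, traceL_id]

/-- An orthogonal projection splits norms. -/
theorem norm_proj_sub_sq {A : E →L[ℝ] E} (hs : ContinuousLinearMap.adjoint A = A)
    (hi : A.comp A = A) (u v : E) : ‖A v - (u - A u)‖ ^ 2 = ‖A v‖ ^ 2 + ‖u - A u‖ ^ 2 := by
  have hA : ∀ w, A (A w) = A w := fun w => congrArg (fun B : E →L[ℝ] E => B w) hi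
  have : ⟪A v, u - A u⟫ = 0 := by
    rw [← hs, ContinuousLinearMap.adjoint_inner_left, hs, map_sub, hA, sub_self, inner_zero_right]
  rw [norm_sub_sq_real, this]
  ring

theorem norm_proj_sq_le {A : E →L[ℝ] E} (hs : ContinuousLinearMap.adjoint A = A)
    (hi : A.comp A = A) (u : E) : ‖A u‖ ^ 2 ≤ ‖u‖ ^ 2 ∧ ‖u - A u‖ ^ 2 ≤ ‖u‖ ^ 2 := by
  -- Taking `v = -u` turns the orthogonal splitting into Pythagoras for `u`.
  have h := norm_proj_sub_sq hs hi u (-u)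
  have e : A (-u) - (u - A u) = -u := by rw [map_neg]; abel
  rw [e, norm_neg, map_neg, norm_neg] at h
  constructor <;> nlinarith [sq_nonneg ‖A u‖, sq_nonneg ‖u - A u‖]

/-- The gradient `2 A x` of `‖G‖²` plus the field `z - 2 x` equals `A z + (I - A)(z - 2 x)`: two
orthogonal pieces, of norm at most `‖z‖` and `‖2 x - z‖`. -/
theorem boundFun_le_of_projection {A : E →L[ℝ] E} (hs : ContinuousLinearMap.adjoint A = A)
    (hi : A.comp A = A) (z x : E) :
    boundFun 1 0 0 (-2) 1 (z, x, A) ≤ sqFun (-2) 1 (z, x, A) + ‖z‖ ^ 2 := by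
  unfold boundFun sqFun
  have e1 : quadGrad 1 0 0 (z, x, A) + ((-2 : ℝ) • x + (1 : ℝ) • z)
      = A z - (((2 : ℝ) • x - z) - A ((2 : ℝ) • x - z)) := by
    simp only [quadGrad, hs, map_sub, map_smul]
    module
  have e2 : (-2 : ℝ) • x + (1 : ℝ) • z = -((2 : ℝ) • x - z) := by module
  dsimp only
  rw [e1, e2, norm_neg, norm_proj_sub_sq hs hi]
  linarith [(norm_proj_sq_le hs hi z).1, (norm_proj_sq_le hs hi ((2 : ℝ) • x - z)).2]

/-- Gradient plus field collapses to `(I - A)(z - 2 x)`, and the trace term is `n - tr A ≤ n`. -/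
theorem boundFun_le_of_projection' {A : E →L[ℝ] E} (hs : ContinuousLinearMap.adjoint A = A)
    (hi : A.comp A = A) (hA : 0 ≤ traceL E A) (z x : E) :
    boundFun 1 (-1) 0 (-1) 1 (z, x, A) ≤ sqFun (-2) 1 (z, x, A) := by
  rw [sqFun_eq_of_idempotent hi]
  unfold boundFun
  have e1 : quadGrad 1 (-1) 0 (z, x, A) + ((-1 : ℝ) • x + (1 : ℝ) • z)
      = -(((2 : ℝ) • x - z) - A ((2 : ℝ) • x - z)) := by
    simp only [quadGrad, hs, map_sub, map_smul]
    module
  dsimp only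
  rw [e1, norm_neg, traceL_one_sub_sq hi]
  linarith [(norm_proj_sq_le hs hi ((2 : ℝ) • x - z)).2]

variable [MeasurableSpace E] [BorelSpace E]

theorem memLp_two_comp_of_lipschitz {G : E → E} {K : ℝ≥0} (hG : LipschitzWith K G)
    {Ψ : E × E × (E →L[ℝ] E) → ℝ} (hΨ : Tame Ψ) :
    MemLp (fun z => Ψ (z, G z, fderiv ℝ G z)) 2 (stdGaussian E) :=
  (memLp_two_iff_integrable_sq (integrable_comp_of_lipschitz hG hΨ).aestronglyMeasurable).2
    (integrable_comp_of_lipschitz hG (hΨ.pow 2))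

/-- The properties of Stein's unbiased risk estimator, and of the estimator of its risk, for a
Lipschitz map of a standard Gaussian vector whose derivative is almost everywhere an orthogonal
projection of rank `D`. -/
theorem sure_of_ae_projection {G : E → E} {K : ℝ≥0} (hG : LipschitzWith K G) {D : E → ℝ}
    (hD : ∀ z, 0 ≤ D z)
    (hproj : ∀ᵐ z ∂(stdGaussian E), ContinuousLinearMap.adjoint (fderiv ℝ G z) = fderiv ℝ G z ∧
      (fderiv ℝ G z).comp (fderiv ℝ G z) = fderiv ℝ G z ∧ traceL E (fderiv ℝ G z) = D z) :
    let n : ℝ := Module.finrank ℝ E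
    let S : E → ℝ := fun z => ‖G z - z‖ ^ 2 + (2 * D z - n)
    let R : E → ℝ := fun z => 4 * ‖G z - z‖ ^ 2 + (4 * D z - 2 * n)
    (MemLp S 2 (stdGaussian E) ∧ MemLp R 2 (stdGaussian E) ∧
      MemLp (fun z => ‖G z - z‖ ^ 2) 2 (stdGaussian E) ∧
      MemLp (fun z => ‖G z‖ ^ 2) 2 (stdGaussian E)) ∧
    ∫ z, S z ∂(stdGaussian E) = ∫ z, ‖G z‖ ^ 2 ∂(stdGaussian E) ∧
    ∫ z, (S z - ‖G z‖ ^ 2) ^ 2 ∂(stdGaussian E) = ∫ z, R z ∂(stdGaussian E) ∧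
    Var[S; stdGaussian E] ≤ (∫ z, R z ∂(stdGaussian E)) + n ∧
    n ≤ ∫ z, R z ∂(stdGaussian E) ∧
    Var[R; stdGaussian E] ≤ 16 * ∫ z, R z ∂(stdGaussian E) := by
  intro n S R
  let T : E → E × E × (E →L[ℝ] E) := fun z => (z, G z, fderiv ℝ G z)
  have hS : S =ᵐ[stdGaussian E] fun z => quadFun 1 0 0 (T z) + divFun (-2) 1 (T z) := by
    filter_upwards [hproj] with z hz
    simp only [S, T, divFun_eq, quadFun, hz.2.2, norm_sub_sq_real, real_inner_comm (G z) z, n]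
    ring
  have hSA : (fun z => (S z - ‖G z‖ ^ 2) ^ 2) =ᵐ[stdGaussian E] fun z => divFun (-2) 1 (T z) ^ 2 := by
    filter_upwards [hS] with z hz
    rw [hz]
    simp only [quadFun, T]
    ring
  -- First decomposition, for the mean: `R` differs from the second order Stein integrand by the
  -- centered divergence of `3 z - 4 G`.
  have hR : R =ᵐ[stdGaussian E] fun z => sqFun (-2) 1 (T z) + divFun (-4) 3 (T z) := by
    filter_upwards [hproj] with z hz
    simp only [R, T, divFun_eq, sqFun_eq_of_idempotent hz.2.1, hz.2.2, norm_sub_sq_real,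
      real_inner_comm (G z) z, n, norm_smul, inner_smul_left, Real.norm_eq_abs, mul_pow]
    simp
    ring
  -- Second decomposition, for the variance; the field `z - G` is the one for which gradient and
  -- field cancel. The factor 4 becomes the 16 of the bound.
  have hR' : R =ᵐ[stdGaussian E]
      fun z => 4 * (quadFun 1 (-1) 0 (T z) + divFun (-1) 1 (T z)) + 2 * n := by
    filter_upwards [hproj] with z hz
    simp only [R, T, divFun_eq, quadFun, hz.2.2, norm_sub_sq_real, real_inner_comm (G z) z, n]
    ring
  have mS : MemLp S 2 (stdGaussian E) := (memLp_congr_ae hS).2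
    (memLp_two_comp_of_lipschitz hG ((tame_quadFun 1 0 0).add (tame_divFun (-2) 1)))
  have mR : MemLp R 2 (stdGaussian E) := (memLp_congr_ae hR).2
    (memLp_two_comp_of_lipschitz hG ((tame_sqFun (-2) 1).add (tame_divFun (-4) 3)))
  have iR : ∫ z, R z ∂(stdGaussian E) = ∫ z, sqFun (-2) 1 (T z) ∂(stdGaussian E) := by
    rw [integral_congr_ae hR, integral_add (integrable_comp_of_lipschitz hG (tame_sqFun (-2) 1))
      (integrable_comp_of_lipschitz hG (tame_divFun (-4) 3)), integral_divFun hG, add_zero]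
  have iS : ∫ z, S z ∂(stdGaussian E) = ∫ z, quadFun 1 0 0 (T z) ∂(stdGaussian E) := by
    rw [integral_congr_ae hS, integral_add (integrable_comp_of_lipschitz hG (tame_quadFun 1 0 0))
      (integrable_comp_of_lipschitz hG (tame_divFun (-2) 1)), integral_divFun hG, add_zero]
  -- The divergence of the identity field is `‖z‖² - n`.
  have iz : ∫ z, ‖z‖ ^ 2 ∂(stdGaussian E) = n := by
    have h1 := integral_divFun hG 0 1
    simp only [divFun_eq] at h1
    simp only [zero_mul, one_mul, zero_add] at h1
    rw [integral_sub ((Tame.id'.norm.pow 2).integrable _) (integrable_const _)] at h1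
    simp only [integral_const, probReal_univ, one_smul] at h1
    linarith
  refine ⟨⟨mS, mR, ?_, ?_⟩, ?_, ?_, ?_, ?_, ?_⟩
  · exact memLp_two_comp_of_lipschitz hG
      (Ψ := fun t => ‖t.2.1 - t.1‖ ^ 2) ((tame_x.sub tame_z).norm.pow 2)
  · exact memLp_two_comp_of_lipschitz hG (Ψ := fun t => ‖t.2.1‖ ^ 2) (tame_x.norm.pow 2)
  · rw [iS]
    simp [quadFun, T]
  · rw [integral_congr_ae hSA, iR]
    exact integral_divFun_sq hG (-2) 1
  · rw [variance_eq_sub mS, iS, iR]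
    have h1 : ∫ z, (S ^ 2) z ∂(stdGaussian E) = ∫ z, (quadFun 1 0 0 (T z)
        + divFun (-2) 1 (T z)) ^ 2 ∂(stdGaussian E) := integral_congr_ae (by
      filter_upwards [hS] with z hz
      rw [Pi.pow_apply, hz])
    rw [h1]
    refine (variance_quadFun_add_divFun_le hG 1 0 0 (-2) 1).trans ?_
    rw [← iz, ← integral_add (integrable_comp_of_lipschitz hG (tame_sqFun (-2) 1))
      ((Tame.id'.norm.pow 2).integrable _)]
    refine integral_mono_ae (integrable_comp_of_lipschitz hG (tame_boundFun _ _ _ _ _))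
      ((integrable_comp_of_lipschitz hG (tame_sqFun (-2) 1)).add
      ((Tame.id'.norm.pow 2).integrable _)) ?_
    filter_upwards [hproj] with z hz
    exact boundFun_le_of_projection hz.1 hz.2.1 z (G z)
  · rw [iR]
    have h1 : n = ∫ _ : E, n ∂(stdGaussian E) := by simp
    rw [h1]
    refine integral_mono_ae (integrable_const _)
      (integrable_comp_of_lipschitz hG (tame_sqFun (-2) 1)) ?_
    filter_upwards [hproj] with z hz
    simp only [T, sqFun_eq_of_idempotent hz.2.1, n]
    linarith [sq_nonneg ‖(2 : ℝ) • G z - z‖]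
  · have mW : MemLp (fun z => quadFun 1 (-1) 0 (T z) + divFun (-1) 1 (T z)) 2 (stdGaussian E) :=
      memLp_two_comp_of_lipschitz hG ((tame_quadFun 1 (-1) 0).add (tame_divFun (-1) 1))
    have h1 : Var[R; stdGaussian E] = 16 *
        Var[fun z => quadFun 1 (-1) 0 (T z) + divFun (-1) 1 (T z); stdGaussian E] := by
      rw [variance_congr hR', variance_add_const (mW.aestronglyMeasurable.const_mul 4),
        variance_const_mul]
      norm_num
    rw [h1, variance_eq_sub mW, iR]
    have h2 : ∫ z, quadFun 1 (-1) 0 (T z) + divFun (-1) 1 (T z) ∂(stdGaussian E)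
        = ∫ z, quadFun 1 (-1) 0 (T z) ∂(stdGaussian E) := by
      rw [integral_add (integrable_comp_of_lipschitz hG (tame_quadFun 1 (-1) 0))
        (integrable_comp_of_lipschitz hG (tame_divFun (-1) 1)), integral_divFun hG, add_zero]
    rw [h2]
    refine mul_le_mul_of_nonneg_left ?_ (by norm_num)
    refine (variance_quadFun_add_divFun_le hG 1 (-1) 0 (-1) 1).trans ?_
    refine integral_mono_ae (integrable_comp_of_lipschitz hG (tame_boundFun _ _ _ _ _))
      (integrable_comp_of_lipschitz hG (tame_sqFun (-2) 1)) ?_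
    filter_upwards [hproj] with z hz
    exact boundFun_le_of_projection' hz.1 hz.2.1 (hz.2.2 ▸ hD z) z (G z)

end Projections

/-! ### Deterministic properties of the Lasso. -/

section Deterministic

variable {n p : ℕ} {X : Matrix (Fin n) (Fin p) ℝ} {lam : ℝ}

theorem fit_add (X : Matrix (Fin n) (Fin p) ℝ) (b c : Fin p → ℝ) :
    fit X (b + c) = fit X b + fit X c := by
  simp [fit, Matrix.mulVec_add]

theorem fit_smul (X : Matrix (Fin n) (Fin p) ℝ) (t : ℝ) (b : Fin p → ℝ) :
    fit X (t • b) = t • fit X b := by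
  simp [fit, Matrix.mulVec_smul]

theorem fit_eq_sum (X : Matrix (Fin n) (Fin p) ℝ) (b : Fin p → ℝ) :
    fit X b = ∑ j, b j • WithLp.toLp 2 (X.col j) := by
  rw [fit]
  ext i
  simp [Matrix.mulVec, dotProduct, mul_comm]

theorem fit_single (X : Matrix (Fin n) (Fin p) ℝ) (j : Fin p) (t : ℝ) :
    fit X (Pi.single j t) = t • WithLp.toLp 2 (X.col j) := by
  rw [fit_eq_sum, Finset.sum_eq_single j] <;> simp +contextual

/-- The variational inequality characterizing the Lasso. -/
theorem IsLasso.inner_le {y : EuclideanSpace ℝ (Fin n)} {b : Fin p → ℝ} (hn : 0 < n)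
    (hl : 0 ≤ lam) (hb : IsLasso X lam y b) (b' : Fin p → ℝ) :
    ⟪y - fit X b, fit X b' - fit X b⟫ ≤ n * lam * (∑ j, |b' j| - ∑ j, |b j|) := by
  have hn' : (0 : ℝ) < n := Nat.cast_pos.2 hn
  set w := fit X b' - fit X b with hw
  set Δ := ∑ j, |b' j| - ∑ j, |b j| with hΔ
  -- Compare `b` with the point at parameter `t` of the segment to `b'`, bound the `ℓ₁` norm by
  -- convexity and divide by `t`; then `t → 0` removes the quadratic term.
  have key : ∀ t : ℝ, 0 < t → t ≤ 1 →
      0 ≤ -(2 * ⟪y - fit X b, w⟫) + 2 * n * lam * Δ + t * ‖w‖ ^ 2 := fun t t0 t1 => by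
    have h := hb (b + t • (b' + (-1 : ℝ) • b))
    have e1 : fit X (b + t • (b' + (-1 : ℝ) • b)) - y = -(y - fit X b) + t • w := by
      simp only [fit_add, fit_smul, hw]
      module
    have e2 : ‖fit X b - y‖ = ‖y - fit X b‖ := norm_sub_rev _ _
    have e3 : ∑ j, |(b + t • (b' + (-1 : ℝ) • b)) j| ≤ ∑ j, |b j| + t * Δ := by
      rw [hΔ, ← Finset.sum_sub_distrib, Finset.mul_sum, ← Finset.sum_add_distrib]
      refine Finset.sum_le_sum fun j _ => ?_
      have : (b + t • (b' + (-1 : ℝ) • b)) j = (1 - t) * b j + t * b' j := by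
        simp only [Pi.add_apply, Pi.smul_apply, smul_eq_mul]; ring
      rw [this]
      refine (abs_add_le _ _).trans (le_of_eq ?_)
      rw [abs_mul, abs_mul, abs_of_nonneg t0.le, abs_of_nonneg (by linarith : 0 ≤ 1 - t)]
      ring
    unfold objective at h
    rw [e1, e2, norm_add_sq_real, norm_neg, inner_neg_left, inner_smul_right, norm_smul,
      mul_pow, Real.norm_eq_abs, sq_abs] at h
    have e4 := mul_le_mul_of_nonneg_left e3 hl
    have h' : ‖y - fit X b‖ ^ 2 / (2 * n) ≤ (‖y - fit X b‖ ^ 2 + 2 * -(t * ⟪y - fit X b, w⟫)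
        + t ^ 2 * ‖w‖ ^ 2) / (2 * n) + t * (lam * Δ) := by linarith
    have h2 : 0 ≤ t * (-(2 * ⟪y - fit X b, w⟫) + 2 * n * lam * Δ + t * ‖w‖ ^ 2) := by
      have := mul_le_mul_of_nonneg_right h' (by positivity : (0 : ℝ) ≤ 2 * n)
      rw [add_mul, div_mul_cancel₀ _ (by positivity), div_mul_cancel₀ _ (by positivity)] at this
      linarith
    exact nonneg_of_mul_nonneg_right h2 t0
  have hlim : Tendsto (fun t : ℝ => -(2 * ⟪y - fit X b, w⟫) + 2 * n * lam * Δ + t * ‖w‖ ^ 2)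
      (𝓝[>] 0) (𝓝 (-(2 * ⟪y - fit X b, w⟫) + 2 * n * lam * Δ + 0 * ‖w‖ ^ 2)) :=
    (Continuous.tendsto (by fun_prop) 0).mono_left nhdsWithin_le_nhds
  have := ge_of_tendsto hlim (by
    filter_upwards [Ioc_mem_nhdsGT (zero_lt_one' ℝ)] with t ht using key t ht.1 ht.2)
  linarith

/-- The Lasso fit is a `1`-Lipschitz function of the data. -/
theorem lipschitzWith_fit {βhat : EuclideanSpace ℝ (Fin n) → Fin p → ℝ} (hn : 0 < n)
    (hl : 0 ≤ lam) (hb : ∀ z, IsLasso X lam z (βhat z)) :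
    LipschitzWith 1 (fun z => fit X (βhat z)) := by
  refine LipschitzWith.of_dist_le_mul fun y z => ?_
  rw [NNReal.coe_one, one_mul, dist_eq_norm, dist_eq_norm]
  have h1 := (hb y).inner_le hn hl (βhat z)
  have h2 := (hb z).inner_le hn hl (βhat y)
  set a := fit X (βhat y)
  set c := fit X (βhat z)
  -- Adding the two variational inequalities cancels the penalties and leaves firm nonexpansiveness.
  have h3 : ‖a - c‖ ^ 2 ≤ ⟪y - z, a - c⟫ := by
    rw [← real_inner_self_eq_norm_sq]
    have e : ⟪y - a, c - a⟫ + ⟪z - c, a - c⟫ = ⟪a - c, a - c⟫ - ⟪y - z, a - c⟫ := by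
      simp only [inner_sub_left, inner_sub_right]; ring
    linarith
  have h4 := h3.trans (real_inner_le_norm _ _)
  rcases (norm_nonneg (a - c)).eq_or_lt with h0 | h0
  · rw [← h0]; exact norm_nonneg _
  · exact le_of_mul_le_mul_right (by rwa [sq] at h4) h0

/-- The stationarity conditions of the Lasso on its support. -/
theorem IsLasso.inner_col {y : EuclideanSpace ℝ (Fin n)} {b : Fin p → ℝ} (hn : 0 < n)
    (hl : 0 ≤ lam) (hb : IsLasso X lam y b) {j : Fin p} (hj : b j ≠ 0) :
    ⟪y - fit X b, WithLp.toLp 2 (X.col j)⟫ = n * lam * (SignType.sign (b j) : ℝ) := by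
  have hsum : ∀ b' : Fin p → ℝ, (∀ i, i ≠ j → b' i = b i) →
      ∑ i, |b' i| - ∑ i, |b i| = |b' j| - |b j| := fun b' h => by
    rw [← Finset.sum_sub_distrib, Finset.sum_eq_single j]
    · intro i _ hi; rw [h i hi, sub_self]
    · simp
  -- Doubling and deleting coordinate `j` give opposite inequalities, hence an equality.
  have h1 := hb.inner_le hn hl (b + Pi.single j (b j))
  have h2 := hb.inner_le hn hl (b + Pi.single j (-(b j)))
  rw [hsum _ fun i hi => by simp [hi], fit_add, fit_single, add_sub_cancel_left,
    inner_smul_right] at h1 h2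
  simp only [Pi.add_apply, Pi.single_eq_same, add_neg_cancel, abs_zero] at h1 h2
  have h3 : |b j + b j| = 2 * |b j| := by rw [← two_mul, abs_mul, abs_two]
  rw [h3] at h1
  have h4 : b j * ⟪y - fit X b, WithLp.toLp 2 (X.col j)⟫ = n * lam * |b j| := by linarith
  refine mul_left_cancel₀ hj ?_
  rw [h4, ← sign_mul_self (b j)]
  ring

/-- Under the rank condition, at most `n + 1` columns whose inner products with a common vector
have the same nonzero absolute value are linearly independent. -/
theorem RankCondition.linearIndependent_of_card_le (hX : RankCondition X) (hnp : n < p)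
    {r : EuclideanSpace ℝ (Fin n)} {c : ℝ} (hc : c ≠ 0) {δ : Fin p → ℝ}
    (hδ : ∀ j, δ j = -1 ∨ δ j = 1) {T : Finset (Fin p)} (hT : T.card ≤ n + 1)
    (hr : ∀ j ∈ T, ⟪r, WithLp.toLp 2 (X.col j)⟫ = c * δ j) :
    LinearIndependent ℝ (fun j : T => (WithLp.toLp 2 (X.col (j : Fin p)) :
      EuclideanSpace ℝ (Fin n))) := by
  classical
  rw [Fintype.linearIndependent_iff]
  intro g hg
  -- The rank condition concerns exactly `n + 1` columns; `n < p` leaves room to enlarge `T`, with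
  -- zero coefficients on the added columns.
  obtain ⟨T', hTT', -, hcard⟩ := Finset.exists_subsuperset_card_eq (Finset.subset_univ T) hT
    (by simpa using hnp)
  let J := T'.orderEmbOfFin hcard
  let a : Fin p → ℝ := fun j => if h : j ∈ T then g ⟨j, h⟩ else 0
  have hsum : ∀ f : Fin p → ℝ, ∑ k, a (J k) * f (J k) = ∑ j : T, g j * f j := fun f => by
    have h1 : ∑ k, a (J k) * f (J k) = ∑ j ∈ T', a j * f j := by
      conv_rhs => rw [← Finset.map_orderEmbOfFin_univ T' hcard, Finset.sum_map]
      rfl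
    rw [h1, ← Finset.sum_subset hTT' fun j _ hj => by simp [a, hj], ← Finset.sum_coe_sort T]
    exact Finset.sum_congr rfl fun j _ => by simp [a]
  have hcoord : ∀ i, ∑ j : T, g j * X i j = 0 := fun i => by
    have := congrArg (fun v : EuclideanSpace ℝ (Fin n) => v i) hg
    simpa using this
  -- Pairing the linear relation with `r` shows that the coefficients also annihilate the row of
  -- signs.
  have hsign : ∑ j : T, g j * δ j = 0 := by
    have h1 := congrArg (fun v => ⟪r, v⟫) hg
    simp only [inner_sum, inner_smul_right, inner_zero_right] at h1
    have h2 : c * ∑ j : T, g j * δ j = 0 := by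
      rw [← h1, Finset.mul_sum]
      exact Finset.sum_congr rfl fun j _ => by rw [hr j j.2]; ring
    exact (mul_eq_zero.1 h2).resolve_left hc
  set M := Matrix.fromRows (X.submatrix id J)
    (Matrix.of fun (_ : Unit) k => δ (J k)) with hM
  have hrank : M.rank = n + 1 := hX δ hδ J J.strictMono
  have hker : M.mulVecLin.ker = ⊥ := by
    have h1 := M.mulVecLin.finrank_range_add_finrank_ker
    rw [← Matrix.rank, hrank] at h1
    simp only [Module.finrank_fintype_fun_eq_card, Fintype.card_fin] at h1
    exact Submodule.finrank_eq_zero.1 (by omega)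
  have hv : (fun k => a (J k)) ∈ M.mulVecLin.ker := by
    rw [LinearMap.mem_ker, Matrix.mulVecLin_apply]
    ext i
    rcases i with i | i
    · simp only [hM, Matrix.mulVec, dotProduct, Matrix.fromRows_apply_inl, Matrix.submatrix_apply,
        id, Pi.zero_apply]
      rw [← hcoord i, ← hsum (fun j => X i j)]
      exact Finset.sum_congr rfl fun k _ => mul_comm _ _
    · simp only [hM, Matrix.mulVec, dotProduct, Matrix.fromRows_apply_inr, Matrix.of_apply,
        Pi.zero_apply]
      rw [← hsign, ← hsum δ]
      exact Finset.sum_congr rfl fun k _ => mul_comm _ _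
  rw [hker, Submodule.mem_bot] at hv
  intro j
  obtain ⟨k, hk⟩ : ∃ k, J k = j := by
    have : (j : Fin p) ∈ Finset.image J Finset.univ := by
      rw [Finset.image_orderEmbOfFin_univ]; exact hTT' j.2
    simpa using this
  have := congrFun hv k
  simpa [a, hk] using this

/-- Under the rank condition, the active columns of the Lasso are linearly independent. -/
theorem IsLasso.linearIndependent (hX : RankCondition X) (hn : 0 < n) (hnp : n < p)
    (hl : 0 < lam) {y : EuclideanSpace ℝ (Fin n)} {b : Fin p → ℝ} (hb : IsLasso X lam y b) :
    LinearIndependent ℝ (fun j : support b => (WithLp.toLp 2 (X.col (j : Fin p)) :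
      EuclideanSpace ℝ (Fin n))) := by
  let δ : Fin p → ℝ := fun j => if b j < 0 then -1 else 1
  have hδ : ∀ j, δ j = -1 ∨ δ j = 1 := fun j => by
    by_cases h : b j < 0 <;> simp [δ, h]
  have hr : ∀ j ∈ support b, ⟪y - fit X b, WithLp.toLp 2 (X.col j)⟫ = (n * lam) * δ j := by
    intro j hj
    have hj : b j ≠ 0 := by simpa [support] using hj
    rw [hb.inner_col hn hl.le hj]
    congr 1
    rcases hj.lt_or_gt with h | h
    · simp [δ, h]
    · simp [δ, h, h.le]
  have hc : (n * lam : ℝ) ≠ 0 := by positivity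
  have key := fun (T : Finset (Fin p)) (hT : T.card ≤ n + 1) (hTS : T ⊆ support b) =>
    hX.linearIndependent_of_card_le hnp hc hδ hT fun j hj => hr j (hTS hj)
  by_cases hS : (support b).card ≤ n + 1
  · exact key _ hS subset_rfl
  -- A larger support would contain `n + 1` independent vectors of `ℝⁿ`.
  · obtain ⟨T, hTS, hT⟩ := Finset.exists_subset_card_eq (le_of_not_ge hS)
    have := (key T hT.le hTS).fintype_card_le_finrank
    rw [Fintype.card_coe, hT, finrank_euclideanSpace_fin] at this
    omega

end Deterministic

/-! ### Almost everywhere derivative of the Lasso fit. -/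

section Derivative

/-- A Lipschitz map agreeing with an affine map on an arbitrary set has the corresponding
derivative at almost every point of the set. -/
theorem ae_fderiv_eq_of_affineOn {E : Type*} [NormedAddCommGroup E] [NormedSpace ℝ E]
    [FiniteDimensional ℝ E] [MeasurableSpace E] [BorelSpace E] (μ : Measure E) [μ.IsAddHaarMeasure]
    {G : E → E} {K : ℝ≥0} (hG : LipschitzWith K G) {s : Set E} {A : E →L[ℝ] E}
    (hs : ∀ x ∈ s, ∀ y ∈ s, G x - G y = A (x - y)) : ∀ᵐ x ∂μ, x ∈ s → fderiv ℝ G x = A := by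
  rcases s.eq_empty_or_nonempty with rfl | ⟨y₀, hy₀⟩
  · simp
  -- `s` need not be measurable; this enlargement is, and `G` is still affine on it.
  let u : Set E := {x | G x - G y₀ = A (x - y₀)} ∩ {x | DifferentiableAt ℝ G x}
  have hu : MeasurableSet u := by
    refine MeasurableSet.inter (IsClosed.measurableSet ?_) (measurableSet_of_differentiableAt ℝ G)
    have := hG.continuous
    exact isClosed_eq (by fun_prop) (by fun_prop)
  have happ : ApproximatesLinearOn G A u 0 := by
    intro x hx y hy
    have h1 : G x - G y₀ = A (x - y₀) := hx.1
    have h2 : G y - G y₀ = A (y - y₀) := hy.1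
    have e : G x - G y - A (x - y) = 0 := by
      rw [sub_eq_zero, ← sub_sub_sub_cancel_right (G x) (G y) (G y₀), h1, h2, ← map_sub,
        sub_sub_sub_cancel_right]
    rw [e, norm_zero]
    positivity
  -- With approximation constant 0, the derivative equals `A` at almost every point of `u`.
  have h1 := happ.norm_fderiv_sub_le μ hu (fderiv ℝ G)
    fun x hx => hx.2.hasFDerivAt.hasFDerivWithinAt
  rw [ae_restrict_iff' hu] at h1
  filter_upwards [h1, hG.ae_differentiableAt] with x hx hd hxs
  have := hx ⟨hs x hxs y₀ hy₀, hd⟩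
  simpa [sub_eq_zero] using this

theorem traceL_starProjection {E : Type*} [NormedAddCommGroup E] [InnerProductSpace ℝ E]
    [FiniteDimensional ℝ E] (U : Submodule ℝ E) :
    traceL E U.starProjection = Module.finrank ℝ U := by
  rw [traceL_apply]
  exact LinearMap.IsProj.trace
    ⟨fun x => U.starProjection_apply_mem x, fun x hx => U.starProjection_eq_self_iff.2 hx⟩

variable {n p : ℕ} {X : Matrix (Fin n) (Fin p) ℝ} {lam : ℝ}

/-- Almost everywhere, the derivative of a rescaled Lasso fit is the orthogonal projection onto the
span of the active columns. -/
theorem ae_fderiv_fit {βhat : EuclideanSpace ℝ (Fin n) → Fin p → ℝ} (hn : 0 < n)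
    (hl : 0 ≤ lam) (hb : ∀ z, IsLasso X lam z (βhat z))
    (hind : ∀ z, LinearIndependent ℝ (fun j : support (βhat z) =>
      (WithLp.toLp 2 (X.col (j : Fin p)) : EuclideanSpace ℝ (Fin n))))
    (μ : EuclideanSpace ℝ (Fin n)) {σ : ℝ} (hσ : 0 < σ) :
    let G : EuclideanSpace ℝ (Fin n) → EuclideanSpace ℝ (Fin n) := fun z =>
      σ⁻¹ • (fit X (βhat (μ + σ • z)) - μ)
    LipschitzWith 1 G ∧ ∀ᵐ z, ContinuousLinearMap.adjoint (fderiv ℝ G z) = fderiv ℝ G z ∧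
      (fderiv ℝ G z).comp (fderiv ℝ G z) = fderiv ℝ G z ∧
      traceL _ (fderiv ℝ G z) = (support (βhat (μ + σ • z))).card := by
  intro G
  have hF := lipschitzWith_fit hn hl hb
  have hG : LipschitzWith 1 G := by
    refine LipschitzWith.of_dist_le_mul fun x y => ?_
    have h1 := hF.dist_le_mul (μ + σ • x) (μ + σ • y)
    rw [NNReal.coe_one, one_mul] at *
    simp only [G, dist_smul₀, dist_sub_right]
    rw [dist_add_left, dist_smul₀] at h1
    rw [norm_inv, Real.norm_of_nonneg hσ.le] at *
    rwa [inv_mul_le_iff₀ hσ]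
  refine ⟨hG, ?_⟩
  let sgn : EuclideanSpace ℝ (Fin n) → Fin p → SignType := fun z j =>
    SignType.sign (βhat (μ + σ • z) j)
  let U : (Fin p → SignType) → Submodule ℝ (EuclideanSpace ℝ (Fin n)) := fun s =>
    Submodule.span ℝ ((fun j => WithLp.toLp 2 (X.col j)) '' {j | s j ≠ 0})
  have hmem : ∀ z, fit X (βhat (μ + σ • z)) ∈ U (sgn z) := fun z => by
    rw [fit_eq_sum]
    refine Submodule.sum_mem _ fun j _ => ?_
    by_cases h : βhat (μ + σ • z) j = 0
    · rw [h, zero_smul]; exact Submodule.zero_mem _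
    · exact Submodule.smul_mem _ _ (Submodule.subset_span ⟨j, by simpa [sgn] using h, rfl⟩)
  have hres : ∀ z j, sgn z j ≠ 0 → ⟪μ + σ • z - fit X (βhat (μ + σ • z)),
      WithLp.toLp 2 (X.col j)⟫ = n * lam * (sgn z j : ℝ) := fun z j hj =>
    (hb _).inner_col hn hl (by simpa [sgn] using hj)
  -- With equal signs, both fits lie in the active span, and the residuals have equal inner products
  -- with the active columns, so their difference is orthogonal to that span.
  have haff : ∀ s, ∀ x ∈ {z | sgn z = s}, ∀ y ∈ {z | sgn z = s},
      G x - G y = (U s).starProjection (x - y) := by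
    rintro s x rfl y hy
    have hy : sgn y = sgn x := hy
    symm
    have e : G x - G y = σ⁻¹ • (fit X (βhat (μ + σ • x)) - fit X (βhat (μ + σ • y))) := by
      simp only [G]; module
    refine Submodule.eq_starProjection_of_mem_orthogonal ?_ ?_
    · rw [e]
      exact Submodule.smul_mem _ _ (Submodule.sub_mem _ (hmem x) (hy ▸ hmem y))
    · have e2 : x - y - (G x - G y) = σ⁻¹ • ((μ + σ • x - fit X (βhat (μ + σ • x)))
          - (μ + σ • y - fit X (βhat (μ + σ • y)))) := by
        rw [e]
        simp only [smul_sub, smul_add, inv_smul_smul₀ hσ.ne']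
        abel
      rw [e2]
      refine Submodule.smul_mem _ _ ((Submodule.mem_orthogonal' _ _).2 fun u hu => ?_)
      induction hu using Submodule.span_induction with
      | mem u hu =>
        obtain ⟨j, hj, rfl⟩ := hu
        rw [inner_sub_left, hres x j hj, hres y j (by rw [hy]; exact hj), hy, sub_self]
      | zero => simp
      | add u v _ _ h1 h2 => rw [inner_add_right, h1, h2, add_zero]
      | smul c u _ h => rw [inner_smul_right, h, mul_zero]
  -- There are finitely many sign vectors, so the exceptional null sets can be united.
  have hall : ∀ᵐ z, ∀ s, z ∈ {z | sgn z = s} → fderiv ℝ G z = (U s).starProjection :=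
    ae_all_iff.2 fun s => ae_fderiv_eq_of_affineOn _ hG (haff s)
  filter_upwards [hall] with z hz
  rw [hz _ rfl]
  refine ⟨(isSelfAdjoint_starProjection _).adjoint_eq, (U (sgn z)).isIdempotentElem_starProjection,
    ?_⟩
  rw [traceL_starProjection]
  have hU : U (sgn z) = Submodule.span ℝ (Set.range (fun j : support (βhat (μ + σ • z)) =>
      (WithLp.toLp 2 (X.col (j : Fin p)) : EuclideanSpace ℝ (Fin n)))) := by
    simp only [U]
    congr 1
    ext v
    simp [sgn, support]
  rw [hU, finrank_span_eq_card (hind _), Fintype.card_coe]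

end Derivative

/-! ### Relative error and confidence bound. -/

section Consequences

variable {Ω : Type*} [MeasurableSpace Ω] {P : Measure Ω}
  {S R A : Ω → ℝ} {σ N : ℝ}

/-- The left side is `Var R / (E R)²`; the variance bound cancels one factor `E R` and the lower
bound controls the other. -/
theorem integral_ratio_sub_one_sq_le (hN : 0 < N) (hσ : 0 < σ) (hR : MemLp R 2 P)
    (hlow : N * σ ^ 4 ≤ ∫ ω, R ω ∂P) (hvar : Var[R; P] ≤ 16 * σ ^ 4 * ∫ ω, R ω ∂P) :
    ∫ ω, |R ω / (∫ ω', R ω' ∂P) - 1| ^ 2 ∂P ≤ 16 / N := by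
  set e := ∫ ω, R ω ∂P with he
  have hs : 0 < σ ^ 4 := by positivity
  have he0 : 0 < e := lt_of_lt_of_le (by positivity) hlow
  have h1 : ∀ ω, |R ω / e - 1| ^ 2 = (R ω - e) ^ 2 / e ^ 2 := fun ω => by
    rw [sq_abs]; field_simp
  simp_rw [h1]
  rw [integral_div, ← variance_eq_integral hR.aemeasurable, div_le_div_iff₀ (by positivity) hN]
  calc Var[R; P] * N ≤ 16 * σ ^ 4 * e * N := by gcongr
    _ = 16 * (N * σ ^ 4) * e := by ring
    _ ≤ 16 * e * e := by gcongr
    _ = 16 * e ^ 2 := by ring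

theorem confidence_bound [IsProbabilityMeasure P] (hN : 0 < N) (hσ : 0 < σ) (hS : MemLp (fun ω => S ω - A ω) 2 P)
    (hR : MemLp R 2 P) (hlow : N * σ ^ 4 ≤ ∫ ω, R ω ∂P)
    (hsq : ∫ ω, (S ω - A ω) ^ 2 ∂P = ∫ ω, R ω ∂P)
    (hvar : Var[R; P] ≤ 16 * σ ^ 4 * ∫ ω, R ω ∂P) {α γ : ℝ} (hα : 0 < α) (hγ : 0 < γ)
    (hNα : 16 < N * α) :
    1 - α - γ ≤ P.real {ω | |S ω - A ω| ^ 2 ≤ γ⁻¹ * R ω * (1 - 4 / √(N * α))⁻¹} := by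
  set e := ∫ ω, R ω ∂P with he
  have hs : 0 < σ ^ 4 := by positivity
  have he0 : 0 < e := lt_of_lt_of_le (by positivity) hlow
  have hsqrt : 4 < √(N * α) := Real.lt_sqrt_of_sq_lt (by norm_num; exact hNα)
  -- The level at which Chebyshev's inequality for `R` gives probability exactly `α`, since `t² N α
  -- = 16`.
  set t := 4 / √(N * α) with ht
  have ht0 : 0 < t := by positivity
  have ht1 : t < 1 := by rw [ht, div_lt_one (by linarith)]; exact hsqrt
  have ht2 : t ^ 2 * (N * α) = 16 := by
    rw [ht, div_pow, Real.sq_sqrt (by positivity), div_mul_cancel₀ _ (by positivity)]; norm_num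
  have b1 : P.real {ω | e / γ ≤ (S ω - A ω) ^ 2} ≤ γ := by
    have := mul_meas_ge_le_integral_of_nonneg (μ := P)
      (Eventually.of_forall fun ω => sq_nonneg (S ω - A ω)) hS.integrable_sq (e / γ)
    rw [hsq] at this
    rw [div_mul_eq_mul_div, div_le_iff₀ hγ] at this
    exact le_of_mul_le_mul_left this he0
  have b2 : P.real {ω | (t * e) ^ 2 ≤ (R ω - e) ^ 2} ≤ α := by
    have h1 := mul_meas_ge_le_integral_of_nonneg (μ := P)
      (Eventually.of_forall fun ω => sq_nonneg (R ω - e))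
      (hR.sub (memLp_const e)).integrable_sq ((t * e) ^ 2)
    have h2 : ∫ ω, (R ω - e) ^ 2 ∂P ≤ 16 * σ ^ 4 * e := by
      rwa [variance_eq_integral hR.aemeasurable] at hvar
    set q := P.real {ω | (t * e) ^ 2 ≤ (R ω - e) ^ 2}
    have h3 : (t * e) ^ 2 * q ≤ (t * e) ^ 2 * α := by
      calc (t * e) ^ 2 * q ≤ 16 * σ ^ 4 * e := h1.trans h2
        _ = t ^ 2 * α * e * (N * σ ^ 4) := by rw [← ht2]; ring
        _ ≤ t ^ 2 * α * e * e := by gcongr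
        _ = _ := by ring
    exact le_of_mul_le_mul_left h3 (by positivity)
  -- Off the two bad events, `(S - A)² < e / γ` and `R > (1 - t) e`, which together give the claimed
  -- bound.
  have hcover : (Set.univ : Set Ω) ⊆
      ({ω | |S ω - A ω| ^ 2 ≤ γ⁻¹ * R ω * (1 - t)⁻¹} ∪ {ω | e / γ ≤ (S ω - A ω) ^ 2})
        ∪ {ω | (t * e) ^ 2 ≤ (R ω - e) ^ 2} := by
    intro ω _
    by_contra hω
    simp only [Set.mem_union, Set.mem_ofPred_eq, not_or, not_le] at hω
    obtain ⟨⟨h1, h2⟩, h3⟩ := hω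
    have h4 := abs_lt_of_sq_lt_sq' h3 (by positivity)
    rw [sq_abs] at h1
    have h5 : e ≤ R ω * (1 - t)⁻¹ := by
      rw [← div_eq_mul_inv, le_div_iff₀ (by linarith)]
      linarith [h4.1]
    have h6 : e / γ ≤ γ⁻¹ * R ω * (1 - t)⁻¹ := by
      rw [div_eq_inv_mul, mul_assoc]
      gcongr
    linarith
  have h1 := measureReal_mono hcover (measure_ne_top P _)
  have h2 := measureReal_union_le (μ := P)
    ({ω | |S ω - A ω| ^ 2 ≤ γ⁻¹ * R ω * (1 - t)⁻¹} ∪ {ω | e / γ ≤ (S ω - A ω) ^ 2})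
    {ω | (t * e) ^ 2 ≤ (R ω - e) ^ 2}
  have h3 := measureReal_union_le (μ := P) {ω | |S ω - A ω| ^ 2 ≤ γ⁻¹ * R ω * (1 - t)⁻¹}
    {ω | e / γ ≤ (S ω - A ω) ^ 2}
  rw [probReal_univ] at h1
  linarith

end Consequences

/-! ### Transfer from the standard Gaussian to the model. -/

theorem map_smul_stdGaussian {ι : Type*} [Fintype ι] [DecidableEq ι] (σ : ℝ) :
    (stdGaussian (EuclideanSpace ℝ ι)).map (fun z => σ • z)
      = multivariateGaussian 0 (σ ^ 2 • (1 : Matrix ι ι ℝ)) := by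
  apply Measure.ext_of_charFun
  ext t
  rw [charFun_map_smul, charFun_stdGaussian, charFun_multivariateGaussian
    (Matrix.PosSemidef.one.smul (sq_nonneg σ))]
  congr 1
  have h : t.ofLp ⬝ᵥ t.ofLp = ‖t‖ ^ 2 := by
    rw [EuclideanSpace.real_norm_sq_eq]
    simp [dotProduct, sq]
  rw [Matrix.smul_mulVec, Matrix.one_mulVec, dotProduct_smul, h, norm_smul,
    Real.norm_eq_abs, ← Complex.ofReal_pow, mul_pow, sq_abs]
  simp
  ring

section

variable {n p : ℕ} {Ω : Type*} [MeasurableSpace Ω] {P : Measure Ω}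
  {X : Matrix (Fin n) (Fin p) ℝ} {μ : EuclideanSpace ℝ (Fin n)} {σ lam : ℝ}
  {ε y : Ω → EuclideanSpace ℝ (Fin n)} {βhat : EuclideanSpace ℝ (Fin n) → Fin p → ℝ}

theorem Model.hasLaw_standardized (m : Model P X μ σ lam ε y βhat) :
    HasLaw (fun ω => σ⁻¹ • ε ω) (stdGaussian (EuclideanSpace ℝ (Fin n))) P := by
  have h1 : HasLaw (fun x : EuclideanSpace ℝ (Fin n) => σ⁻¹ • x)
      (stdGaussian (EuclideanSpace ℝ (Fin n)))
      (multivariateGaussian 0 (σ ^ 2 • (1 : Matrix (Fin n) (Fin n) ℝ))) := by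
    refine ⟨by fun_prop, ?_⟩
    rw [← map_smul_stdGaussian, Measure.map_map (by fun_prop) (by fun_prop)]
    have : (fun x : EuclideanSpace ℝ (Fin n) => σ⁻¹ • x) ∘ (fun z => σ • z) = id := by
      ext1 z
      simp [inv_smul_smul₀ m.sigma_pos.ne']
    rw [this, Measure.map_id]
  exact h1.comp m.noise

/-- The rank condition covers `n < p` with `lam > 0`; the selection rule covers the rest. -/
theorem Model.linearIndependent (m : Model P X μ σ lam ε y βhat) (z : EuclideanSpace ℝ (Fin n)) :
    LinearIndependent ℝ (fun j : support (βhat z) => (WithLp.toLp 2 (X.col (j : Fin p)) :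
      EuclideanSpace ℝ (Fin n))) := by
  by_cases h : p ≤ n ∨ lam = 0
  · have := m.selection h z
    exact this.map' (WithLp.linearEquiv 2 ℝ (Fin n → ℝ)).symm.toLinearMap (LinearEquiv.ker _)
  · push Not at h
    exact (m.isLasso z).linearIndependent m.design m.n_pos h.1
      (lt_of_le_of_ne m.lam_nonneg (Ne.symm h.2))

/-- Scaling: the loss and SURE are `σ²` times, and `R` is `σ⁴` times, their counterparts for `G` at
the standardized noise. -/
theorem Model.moments (m : Model P X μ σ lam ε y βhat) :
    let Xβ : Ω → EuclideanSpace ℝ (Fin n) := fun ω => fit X (βhat (y ω))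
    let S : Ω → ℝ := fun ω => sure X σ (y ω) (βhat (y ω))
    let R : Ω → ℝ := fun ω => sureForSure X σ (y ω) (βhat (y ω))
    (MemLp S 2 P ∧ MemLp R 2 P ∧
      MemLp (fun ω => ‖y ω - Xβ ω‖ ^ 2) 2 P ∧ MemLp (fun ω => ‖Xβ ω - μ‖ ^ 2) 2 P) ∧
    ∫ ω, S ω ∂P = ∫ ω, ‖Xβ ω - μ‖ ^ 2 ∂P ∧
    ∫ ω, (S ω - ‖Xβ ω - μ‖ ^ 2) ^ 2 ∂P = ∫ ω, R ω ∂P ∧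
    Var[S; P] ≤ (∫ ω, R ω ∂P) + σ ^ 4 * n ∧
    n * σ ^ 4 ≤ ∫ ω, R ω ∂P ∧
    Var[R; P] ≤ 16 * σ ^ 4 * ∫ ω, R ω ∂P := by
  intro Xβ S R
  have hσ := m.sigma_pos
  obtain ⟨hG, hproj⟩ := ae_fderiv_fit m.n_pos m.lam_nonneg m.isLasso m.linearIndependent μ hσ
  have hZ := m.hasLaw_standardized
  set G : EuclideanSpace ℝ (Fin n) → EuclideanSpace ℝ (Fin n) := fun z =>
    σ⁻¹ • (fit X (βhat (μ + σ • z)) - μ) with hGdef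
  let D : EuclideanSpace ℝ (Fin n) → ℝ := fun z => (support (βhat (μ + σ • z))).card
  have core := sure_of_ae_projection hG (D := D) (fun z => Nat.cast_nonneg _)
    (stdGaussian_absolutelyContinuous.ae_le hproj)
  simp only [finrank_euclideanSpace_fin] at core
  obtain ⟨⟨mS, mR, mB, mA⟩, c1, c2, c3, c4, c5⟩ := core
  set S₀ : EuclideanSpace ℝ (Fin n) → ℝ := fun z => ‖G z - z‖ ^ 2 + (2 * D z - n) with hS₀
  set R₀ : EuclideanSpace ℝ (Fin n) → ℝ := fun z => 4 * ‖G z - z‖ ^ 2 + (4 * D z - 2 * n) with hR₀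
  set Z : Ω → EuclideanSpace ℝ (Fin n) := fun ω => σ⁻¹ • ε ω with hZdef
  have hy : ∀ ω, y ω = μ + σ • Z ω := fun ω => by
    rw [m.observation, hZdef]; simp only [smul_inv_smul₀ hσ.ne']
  have hXβ : ∀ ω, Xβ ω = μ + σ • G (Z ω) := fun ω => by
    simp only [Xβ, hy, hGdef, smul_inv_smul₀ hσ.ne', add_sub_cancel]
  have eA : ∀ ω, ‖Xβ ω - μ‖ ^ 2 = σ ^ 2 * ‖G (Z ω)‖ ^ 2 := fun ω => by
    rw [hXβ, add_sub_cancel_left, norm_smul, mul_pow, Real.norm_eq_abs, sq_abs]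
  have eB : ∀ ω, ‖y ω - Xβ ω‖ ^ 2 = σ ^ 2 * ‖G (Z ω) - Z ω‖ ^ 2 := fun ω => by
    rw [hXβ, hy, add_sub_add_left_eq_sub, ← smul_sub, norm_smul, mul_pow, Real.norm_eq_abs, sq_abs,
      norm_sub_rev]
  have hD : ∀ ω, ((support (βhat (y ω))).card : ℝ) = D (Z ω) := fun ω => by
    simp only [D, ← hy]
  have eS : ∀ ω, S ω = σ ^ 2 * S₀ (Z ω) := fun ω => by
    have := eB ω
    simp only [Xβ] at this
    simp only [S, sure, this, hD, hS₀]
    ring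
  have eR : ∀ ω, R ω = σ ^ 4 * R₀ (Z ω) := fun ω => by
    have := eB ω
    simp only [Xβ] at this
    simp only [R, sureForSure, this, hD, hR₀]
    ring
  have hmem : ∀ {f : EuclideanSpace ℝ (Fin n) → ℝ} (c : ℝ),
      MemLp f 2 (stdGaussian (EuclideanSpace ℝ (Fin n))) → MemLp (fun ω => c * f (Z ω)) 2 P :=
    fun c hf => by
      rw [← hZ.map_eq] at hf
      exact (hf.comp_of_map hZ.aemeasurable).const_mul c
  have hint : ∀ {f : EuclideanSpace ℝ (Fin n) → ℝ},
      AEStronglyMeasurable f (stdGaussian (EuclideanSpace ℝ (Fin n))) →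
        ∫ ω, f (Z ω) ∂P = ∫ z, f z ∂(stdGaussian (EuclideanSpace ℝ (Fin n))) :=
    fun hf => hZ.integral_comp hf
  have hvar : ∀ {f : EuclideanSpace ℝ (Fin n) → ℝ} (c : ℝ),
      MemLp f 2 (stdGaussian (EuclideanSpace ℝ (Fin n))) → Var[fun ω => c * f (Z ω); P]
        = c ^ 2 * Var[f; stdGaussian (EuclideanSpace ℝ (Fin n))] := fun c hf => by
    rw [variance_const_mul]
    congr 1
    rw [← hZ.map_eq] at hf ⊢
    exact (variance_map hf.aemeasurable hZ.aemeasurable).symm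
  have fS : S = fun ω => σ ^ 2 * S₀ (Z ω) := funext eS
  have fR : R = fun ω => σ ^ 4 * R₀ (Z ω) := funext eR
  have iR : ∫ ω, R ω ∂P = σ ^ 4 * ∫ z, R₀ z ∂(stdGaussian (EuclideanSpace ℝ (Fin n))) := by
    simp_rw [eR]
    rw [integral_const_mul, hint mR.aestronglyMeasurable]
  have hs : 0 < σ ^ 4 := by positivity
  refine ⟨⟨?_, ?_, ?_, ?_⟩, ?_, ?_, ?_, ?_, ?_⟩
  · rw [fS]; exact hmem _ mS
  · rw [fR]; exact hmem _ mR
  · simp_rw [eB]; exact hmem _ mB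
  · simp_rw [eA]; exact hmem _ mA
  · simp_rw [eS, eA]
    rw [integral_const_mul, integral_const_mul, hint mS.aestronglyMeasurable,
      hint (f := fun z => ‖G z‖ ^ 2) mA.aestronglyMeasurable, c1]
  · rw [iR, ← c2]
    have h1 : ∀ ω, (S ω - ‖Xβ ω - μ‖ ^ 2) ^ 2 = σ ^ 4 * (S₀ (Z ω) - ‖G (Z ω)‖ ^ 2) ^ 2 := fun ω => by
      rw [eS, eA]; ring
    simp_rw [h1]
    rw [integral_const_mul, hint (f := fun z => (S₀ z - ‖G z‖ ^ 2) ^ 2)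
      ((mS.aestronglyMeasurable.sub mA.aestronglyMeasurable).pow 2)]
  · rw [iR, fS, hvar _ mS]
    calc (σ ^ 2) ^ 2 * Var[S₀; stdGaussian (EuclideanSpace ℝ (Fin n))]
        = σ ^ 4 * Var[S₀; stdGaussian (EuclideanSpace ℝ (Fin n))] := by ring
      _ ≤ σ ^ 4 * ((∫ z, R₀ z ∂(stdGaussian (EuclideanSpace ℝ (Fin n)))) + n) := by gcongr
      _ = _ := by ring
  · rw [iR, mul_comm]
    gcongr
  · rw [iR, fR, hvar _ mR]
    calc (σ ^ 4) ^ 2 * Var[R₀; stdGaussian (EuclideanSpace ℝ (Fin n))]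
        ≤ (σ ^ 4) ^ 2 * (16 * ∫ z, R₀ z ∂(stdGaussian (EuclideanSpace ℝ (Fin n)))) := by gcongr
      _ = _ := by ring

theorem Model.ratio_sub_one [IsProbabilityMeasure P] (m : Model P X μ σ lam ε y βhat) :
    let R : Ω → ℝ := fun ω => sureForSure X σ (y ω) (βhat (y ω))
    MemLp (fun ω => R ω / (∫ ω', R ω' ∂P) - 1) 2 P ∧
      ∫ ω, |R ω / (∫ ω', R ω' ∂P) - 1| ^ 2 ∂P ≤ 16 / n := by
  intro R
  obtain ⟨⟨-, mR, -, -⟩, -, -, -, hlow, hvar⟩ := m.moments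
  refine ⟨?_, integral_ratio_sub_one_sq_le (Nat.cast_pos.2 m.n_pos) m.sigma_pos mR hlow hvar⟩
  simp_rw [div_eq_mul_inv]
  exact (mR.mul_const _).sub (memLp_const 1)

end

/-! ### Convergence in `L₂` and in probability, and the main theorem. -/

theorem eLpNorm_two_le_of_integral_sq_le {Ω : Type*} [MeasurableSpace Ω] {P : Measure Ω}
    {f : Ω → ℝ} (hf : MemLp f 2 P) {c : ℝ} (h : ∫ ω, |f ω| ^ 2 ∂P ≤ c) :
    eLpNorm f 2 P ≤ ENNReal.ofReal √c := by
  rw [hf.eLpNorm_eq_integral_rpow_norm (by norm_num) (by norm_num)]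
  refine ENNReal.ofReal_le_ofReal ?_
  rw [Real.sqrt_eq_rpow]
  simp only [ENNReal.toReal_ofNat, Real.rpow_ofNat, Real.norm_eq_abs, one_div]
  gcongr

theorem measure_le_abs_le_of_integral_sq_le {Ω : Type*} [MeasurableSpace Ω] {P : Measure Ω}
    [IsProbabilityMeasure P] {f : Ω → ℝ} (hf : MemLp f 2 P) {c : ℝ}
    (h : ∫ ω, |f ω| ^ 2 ∂P ≤ c) {δ : ℝ} (hδ : 0 < δ) :
    P {ω | δ ≤ |f ω|} ≤ ENNReal.ofReal (c / δ ^ 2) := by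
  have h1 := mul_meas_ge_le_integral_of_nonneg (μ := P) (f := fun ω => |f ω| ^ 2)
    (Eventually.of_forall fun ω => sq_nonneg _) (by simpa using hf.integrable_sq) (δ ^ 2)
  have h2 : {ω | δ ≤ |f ω|} = {ω | δ ^ 2 ≤ |f ω| ^ 2} := by
    ext ω
    simp only [Set.mem_ofPred_eq]
    exact (pow_le_pow_iff_left₀ hδ.le (abs_nonneg _) two_ne_zero).symm
  rw [h2, ← ofReal_measureReal (measure_ne_top P _)]
  refine ENNReal.ofReal_le_ofReal ?_
  rw [le_div_iff₀ (by positivity)]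
  linarith

end LassoSURE

theorem mainTheorem11 :
    (∀ {n p : ℕ} {Ω : Type*} [MeasurableSpace Ω] (P : Measure Ω) [IsProbabilityMeasure P]
      (X : Matrix (Fin n) (Fin p) ℝ) (μ : EuclideanSpace ℝ (Fin n)) (σ lam : ℝ)
      (ε y : Ω → EuclideanSpace ℝ (Fin n))
      (βhat : EuclideanSpace ℝ (Fin n) → Fin p → ℝ),
      LassoSURE.Model P X μ σ lam ε y βhat →
      let Xβ : Ω → EuclideanSpace ℝ (Fin n) := fun ω => LassoSURE.fit X (βhat (y ω))
      let S : Ω → ℝ := fun ω => LassoSURE.sure X σ (y ω) (βhat (y ω))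
      let R : Ω → ℝ := fun ω => LassoSURE.sureForSure X σ (y ω) (βhat (y ω))
      -- all the random variables below are square integrable
      (MemLp S 2 P ∧ MemLp R 2 P ∧
        MemLp (fun ω => ‖y ω - Xβ ω‖ ^ 2) 2 P ∧ MemLp (fun ω => ‖Xβ ω - μ‖ ^ 2) 2 P) ∧
      -- (i)
      (Var[S; P] = ∫ ω, (S ω - ∫ ω', ‖Xβ ω' - μ‖ ^ 2 ∂P) ^ 2 ∂P ∧
        Var[S; P] ≤ (∫ ω, R ω ∂P) + σ ^ 4 * n) ∧
      -- (ii)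
      (∫ ω, R ω ∂P = 2 * σ ^ 2 * ∫ ω, (‖y ω - Xβ ω‖ ^ 2 + S ω) ∂P ∧
        n * σ ^ 4 ≤ ∫ ω, R ω ∂P) ∧
      -- (iii)
      Var[R; P] ≤ 16 * σ ^ 4 * ∫ ω, R ω ∂P ∧
      -- (iv), the non-asymptotic bound
      ∫ ω, |R ω / (∫ ω', R ω' ∂P) - 1| ^ 2 ∂P ≤ 16 / n ∧
      -- (v)
      (∀ α γ : ℝ, 0 < α → α < 1 → 0 < γ → γ < 1 → 16 < n * α →
        1 - α - γ ≤ P.real {ω |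
          |S ω - ‖Xβ ω - μ‖ ^ 2| ^ 2 ≤ γ⁻¹ * R ω * (1 - 4 / √(n * α))⁻¹})) ∧
    -- (iv), consistency along any sequence of models with `n → ∞`
    (∀ (n p : ℕ → ℕ) (Ω : ℕ → Type*) [∀ k, MeasurableSpace (Ω k)] (P : ∀ k, Measure (Ω k))
      [∀ k, IsProbabilityMeasure (P k)]
      (X : ∀ k, Matrix (Fin (n k)) (Fin (p k)) ℝ) (μ : ∀ k, EuclideanSpace ℝ (Fin (n k)))
      (σ lam : ℕ → ℝ) (ε y : ∀ k, Ω k → EuclideanSpace ℝ (Fin (n k)))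
      (βhat : ∀ k, EuclideanSpace ℝ (Fin (n k)) → Fin (p k) → ℝ),
      (∀ k, LassoSURE.Model (P k) (X k) (μ k) (σ k) (lam k) (ε k) (y k) (βhat k)) →
      Tendsto n atTop atTop →
      let R : ∀ k, Ω k → ℝ := fun k ω =>
        LassoSURE.sureForSure (X k) (σ k) (y k ω) (βhat k (y k ω))
      let ratio : ∀ k, Ω k → ℝ := fun k ω => R k ω / ∫ ω', R k ω' ∂(P k)
      Tendsto (fun k => eLpNorm (fun ω => ratio k ω - 1) 2 (P k)) atTop (𝓝 0) ∧
      ∀ δ : ℝ, 0 < δ →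
        Tendsto (fun k => P k {ω | δ ≤ |ratio k ω - 1|}) atTop (𝓝 0)) := by
  refine ⟨?_, ?_⟩
  · intro n p Ω _ P _ X μ σ lam ε y βhat m Xβ S R
    obtain ⟨hmem, h1, h2, h3, h4, h5⟩ := m.moments
    have hn : (0 : ℝ) < n := Nat.cast_pos.2 m.n_pos
    refine ⟨hmem, ⟨?_, h3⟩, ⟨?_, h4⟩, h5, m.ratio_sub_one.2, ?_⟩
    · rw [← h1]
      exact variance_eq_integral hmem.1.aemeasurable
    · rw [← integral_const_mul]
      refine integral_congr_ae (Eventually.of_forall fun ω => ?_)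
      simp only [R, S, Xβ, LassoSURE.sureForSure, LassoSURE.sure]
      ring
    · intro α γ hα _ hγ _ hnα
      exact LassoSURE.confidence_bound hn m.sigma_pos (hmem.1.sub hmem.2.2.2) hmem.2.1 h4 h2 h5
        hα hγ hnα
  · intro n p Ω _ P _ X μ σ lam ε y βhat m hn R ratio
    have hlim : ∀ c : ℝ, Tendsto (fun k => 16 / (n k : ℝ) / c) atTop (𝓝 0) := fun c => by
      simpa using (tendsto_const_nhds.div_atTop
        (tendsto_natCast_atTop_atTop.comp hn) : Tendsto (fun k => 16 / (n k : ℝ)) atTop _).div_const c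
    refine ⟨?_, fun δ hδ => ?_⟩
    · refine tendsto_of_tendsto_of_tendsto_of_le_of_le tendsto_const_nhds ?_
        (fun _ => zero_le) (fun k => LassoSURE.eLpNorm_two_le_of_integral_sq_le
          (m k).ratio_sub_one.1 (m k).ratio_sub_one.2)
      simpa using ENNReal.tendsto_ofReal (hlim 1).sqrt
    · refine tendsto_of_tendsto_of_tendsto_of_le_of_le tendsto_const_nhds ?_
        (fun _ => zero_le) (fun k => LassoSURE.measure_le_abs_le_of_integral_sq_le
          (m k).ratio_sub_one.1 (m k).ratio_sub_one.2 hδ)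
      simpa using ENNReal.tendsto_ofReal (hlim (δ ^ 2))
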